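/- Let $\mathrm{Diff}^{2,\Delta}_+([0,1])$ be the set of orientation-preserving $C^2$ diffeomorphisms of $[0,1]$ with no fixed point in $(0,1)$, and let $\mathrm{var}$ denote total variation. For $f$ in this set, the asymptotic distortion of $f$ is $$\mathrm{dist}_\infty(f) := \lim_{n\to\infty} \tfrac1n\, \mathrm{var}\big(\log Df^n;[0,1]\big).$$ A left (resp. right) generating vector field of $f$ is a vector field $X$ on $[0,1)$ (resp. $Y$ on $(0,1]$) of class $C^1$ there, with complete flow $(f_t)_{t\in\mathbb R}$ (resp. $(f^t)_{t\in\mathbb R}$), whose time-$1$ map is the restriction of $f$. The representatives of the Mather invariant $M_f$ are the maps $M:=\psi_Y^{-1}\circ\psi_X:\mathbb R\to\mathbb R$, where $\psi_X(t):=f_t(a)$ and $\psi_Y(t):=f^t(b)$ are the parametrizations of $(0,1)$ given by these flows and by base points $a,b\in(0,1)$; for such an $M$ one sets $\mathrm{var}(\log DM_f):=\mathrm{var}(\log DM;[0,1])$. **Theorem.** Let $f\in\mathrm{Diff}^{2,\Delta}_+([0,1])$. Then the objects above are well defined: the representatives of $M_f$ are exactly the lifts to $\mathbb R$ of the members of a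 single class of orientation-preserving $C^2$ diffeomorphisms of $\mathbb R/\mathbb Z$ modulo pre- and post-composition with rotations; all the total variations above are finite; and the limit defining $\mathrm{dist}_\infty(f)$ exists. Moreover, for every representative of $M_f$, $$\big|\mathrm{dist}_\infty(f)-\mathrm{var}(\log DM_f)\big|\le|\log Df(0)|+|\log Df(1)|.$$ In particular, $\mathrm{dist}_\infty(f)=\mathrm{var}(\log DM_f)$ if $f$ is tangent to the identity at both endpoints, that is, if $Df(0)=Df(1)=1$. -/

import Mathlib

open Set Filter Topology

/-- `f` restricted to `[0,1]` is an orientation-preserving `C^2` diffeomorphism of `[0,1]` without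
fixed point in the open interval. The values of `f` outside `[0,1]` play no role. -/
structure IsDiffTwoDelta (f : ℝ → ℝ) : Prop where
  mapsTo : MapsTo f (Icc 0 1) (Icc 0 1)
  strictMonoOn : StrictMonoOn f (Icc 0 1)
  contDiffOn : ContDiffOn ℝ 2 f (Icc 0 1)
  exists_inverse : ∃ g : ℝ → ℝ, MapsTo g (Icc 0 1) (Icc 0 1) ∧
    InvOn g f (Icc 0 1) (Icc 0 1) ∧ ContDiffOn ℝ 2 g (Icc 0 1)
  no_fixed_point : ∀ x ∈ Ioo (0 : ℝ) 1, f x ≠ x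

/-- The function `log Df` on `[0,1]`, with one-sided derivatives at the endpoints. -/
noncomputable def logDerivUnit (f : ℝ → ℝ) (x : ℝ) : ℝ :=
  Real.log (derivWithin f (Icc 0 1) x)

/-- The total variation over `[0,1]` (a real number; meaningful if the variation is finite). -/
noncomputable def unitVar (u : ℝ → ℝ) : ℝ :=
  (eVariationOn u (Icc 0 1)).toReal

/-- The asymptotic distortion `lim (1/n) var (log D(f^n))`. -/
noncomputable def asymptoticDistortion (f : ℝ → ℝ) : ℝ :=
  limUnder atTop fun n : ℕ => (1 / (n : ℝ)) * unitVar (logDerivUnit f^[n])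

/-- `Φ t` is the time-`t` map of the (complete) flow on `S` of the vector field `X`. -/
def IsFlowOn (X : ℝ → ℝ) (S : Set ℝ) (Φ : ℝ → ℝ → ℝ) : Prop :=
  ∀ x ∈ S, Φ 0 x = x ∧
    ∀ t : ℝ, Φ t x ∈ S ∧ HasDerivAt (fun s => Φ s x) (X (Φ t x)) t

/-- `X` is a `C^1` vector field on `S` with flow `Φ`, and `f` is the time-one map of this flow.
With `S = [0,1)` and `S = (0,1]` these are the left and right generating (Szekeres) vector fields
of `f`. -/
structure IsGeneratingField (f : ℝ → ℝ) (S : Set ℝ) (X : ℝ → ℝ) (Φ : ℝ → ℝ → ℝ) : Prop where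
  contDiffOn : ContDiffOn ℝ 1 X S
  isFlowOn : IsFlowOn X S Φ
  time_one : ∀ x ∈ S, Φ 1 x = f x

/-- The Mather invariant of `f`, as the set of its representatives (lifted to the real line):
the maps `M = ψ_Y⁻¹ ∘ ψ_X`, where `ψ_X t = Φ t a` and `ψ_Y t = Ψ t b` are the parametrizations of
`(0,1)` by the flows of the left and right generating vector fields from base points `a`, `b`. -/
def matherInvariant (f : ℝ → ℝ) : Set (ℝ → ℝ) :=
  {M | ∃ (X Y : ℝ → ℝ) (Φ Ψ : ℝ → ℝ → ℝ) (a b : ℝ),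
    IsGeneratingField f (Ico 0 1) X Φ ∧ IsGeneratingField f (Ioc 0 1) Y Ψ ∧
    a ∈ Ioo (0 : ℝ) 1 ∧ b ∈ Ioo (0 : ℝ) 1 ∧ ∀ t : ℝ, Ψ (M t) b = Φ t a}

/-- `M` is the lift to the real line of an orientation-preserving `C^2` diffeomorphism
of the circle `ℝ/ℤ`. -/
def IsCircleDiffTwoLift (M : ℝ → ℝ) : Prop :=
  ContDiff ℝ 2 M ∧ (∀ t, 0 < deriv M t) ∧ ∀ t, M (t + 1) = M t + 1

/-- `C` is the set of all lifts of the members of one class of `C^2` circle diffeomorphisms modulo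
pre- and post-composition with rotations. -/
def IsRotationClass (C : Set (ℝ → ℝ)) : Prop :=
  ∃ M₀, IsCircleDiffTwoLift M₀ ∧ C = {M | ∃ r s : ℝ, M = fun t => M₀ (t + r) + s}

/-!
The two generating vector fields exist by Szekeres' construction. For a contraction `f` of `[0,1)`,
the pullbacks by `f^n` of the field `x - f x` converge: the distortion of each step is bounded by a
Lipschitz constant of `log Df` times the length of the step, and the steps of an orbit add up to at
most `1`. The same summation shows that the derivatives converge locally uniformly on `[0,1)`, so
that the limit is a `C^1` field invariant under `f` (`IsDiffTwoDelta.exists_invariant_field`). The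
time function of the limit changes by a constant under `f`; rescaled, the field generates `f`
(`IsDiffTwoDelta.exists_isGeneratingField_of_lt`). Uniqueness holds because the quotient of two
generating fields is invariant under `f` and tends to `1` at the endpoint
(`IsGeneratingField.eqOn_of_lt`). Passing to the inverse and conjugating by `x ↦ 1 - x` give the
other direction of motion and the other endpoint.

Let `X` and `Y` be the left and right fields, and `M` a change of time from an orbit `φ` of `X` to
an orbit of `Y`. Then `DM = (X / Y) ∘ φ`, so `M` is `C^2`, and `var (log DM; [0,1])` is the
variation `W` of `log (X / Y)` over one fundamental domain. By uniqueness of the fields, other representatives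
only translate time in the source and in the target (`isRotationClass_matherInvariant`).

The limit defining the distortion exists by subadditivity. To compare it with `W`, suppose
`f x > x`, with inverse `g`, and cut `[0,1]` at `g^n a` and `a`. On the two outer pieces the
variation of `log Df^n` is at most a sum of `n` terms tending to zero, hence `o(n)`. On the middle piece
`log Df^n = log (X / Y) + log (Y ∘ f^n) - log X`, by invariance of `Y`. The first term has variation
`n W`. Over the successive fundamental domains, which have unit duration, the variation of `log X`
is at most the supremum of `|DX|`; this tends to `|DX(0)| = |log Df(0)|`, and similarly for `Y` at `1`.
Cesàro averaging gives the inequality (`IsOrbit.exists_abs_unitVar_sub_le`).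
-/

/-! ### Diffeomorphisms of the interval without interior fixed points -/

namespace IsDiffTwoDelta

variable {f g : ℝ → ℝ} {x : ℝ}

lemma surjOn (hf : IsDiffTwoDelta f) : SurjOn f (Icc 0 1) (Icc 0 1) := by
  obtain ⟨g, hg, hinv, -⟩ := hf.exists_inverse
  exact hinv.2.surjOn hg

lemma map_zero (hf : IsDiffTwoDelta f) : f 0 = 0 := by
  obtain ⟨x, hx, hx0⟩ := hf.surjOn (left_mem_Icc.2 zero_le_one)
  refine le_antisymm ?_ (hf.mapsTo (left_mem_Icc.2 zero_le_one)).1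
  nth_rw 2 [← hx0]
  exact hf.strictMonoOn.monotoneOn (left_mem_Icc.2 zero_le_one) hx hx.1

lemma map_one (hf : IsDiffTwoDelta f) : f 1 = 1 := by
  obtain ⟨x, hx, hx0⟩ := hf.surjOn (right_mem_Icc.2 zero_le_one)
  refine le_antisymm (hf.mapsTo (right_mem_Icc.2 zero_le_one)).2 ?_
  nth_rw 1 [← hx0]
  exact hf.strictMonoOn.monotoneOn hx (right_mem_Icc.2 zero_le_one) hx.2

lemma mapsTo_Ioo (hf : IsDiffTwoDelta f) : MapsTo f (Ioo 0 1) (Ioo 0 1) := by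
  intro x hx
  have h0 := hf.strictMonoOn (left_mem_Icc.2 zero_le_one) (Ioo_subset_Icc_self hx) hx.1
  have h1 := hf.strictMonoOn (Ioo_subset_Icc_self hx) (right_mem_Icc.2 zero_le_one) hx.2
  rw [hf.map_zero] at h0
  rw [hf.map_one] at h1
  exact ⟨h0, h1⟩

lemma mapsTo_Ico (hf : IsDiffTwoDelta f) : MapsTo f (Ico 0 1) (Ico 0 1) := by
  intro x hx
  have h1 := hf.strictMonoOn (Ico_subset_Icc_self hx) (right_mem_Icc.2 zero_le_one) hx.2
  rw [hf.map_one] at h1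
  exact ⟨(hf.mapsTo (Ico_subset_Icc_self hx)).1, h1⟩

lemma hasDerivWithinAt (hf : IsDiffTwoDelta f) (hx : x ∈ Icc (0 : ℝ) 1) :
    HasDerivWithinAt f (derivWithin f (Icc 0 1) x) (Icc 0 1) x :=
  ((hf.contDiffOn.differentiableOn (by norm_num)) x hx).hasDerivWithinAt

lemma derivWithin_pos (hf : IsDiffTwoDelta f) (hx : x ∈ Icc (0 : ℝ) 1) :
    0 < derivWithin f (Icc 0 1) x := by
  obtain ⟨g, hg, hinv, hgc⟩ := hf.exists_inverse
  have hu : UniqueDiffWithinAt ℝ (Icc (0 : ℝ) 1) x := uniqueDiffOn_Icc zero_lt_one x hx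
  have h1 := hf.hasDerivWithinAt hx
  have h2 : HasDerivWithinAt g (derivWithin g (Icc 0 1) (f x)) (Icc 0 1) (f x) :=
    ((hgc.differentiableOn (by norm_num)) _ (hf.mapsTo hx)).hasDerivWithinAt
  have h3 : HasDerivWithinAt (g ∘ f) _ (Icc 0 1) x := h2.comp x h1 hf.mapsTo
  have h4 : HasDerivWithinAt (g ∘ f) 1 (Icc 0 1) x :=
    (hasDerivWithinAt_id x _).congr (fun y hy => hinv.1 hy) (hinv.1 hx)
  have h5 := hu.eq_deriv _ h3 h4
  refine lt_of_le_of_ne hf.strictMonoOn.monotoneOn.derivWithin_nonneg ?_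
  intro h0
  rw [← h0, mul_zero] at h5
  exact zero_ne_one h5

lemma exp_logDerivUnit (hf : IsDiffTwoDelta f) (hx : x ∈ Icc (0 : ℝ) 1) :
    Real.exp (logDerivUnit f x) = derivWithin f (Icc 0 1) x :=
  Real.exp_log (hf.derivWithin_pos hx)

lemma hasDerivWithinAt_exp (hf : IsDiffTwoDelta f) (hx : x ∈ Icc (0 : ℝ) 1) :
    HasDerivWithinAt f (Real.exp (logDerivUnit f x)) (Icc 0 1) x := by
  rw [hf.exp_logDerivUnit hx]
  exact hf.hasDerivWithinAt hx

lemma hasDerivAt_exp (hf : IsDiffTwoDelta f) (hx : x ∈ Ioo (0 : ℝ) 1) :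
    HasDerivAt f (Real.exp (logDerivUnit f x)) x :=
  (hf.hasDerivWithinAt_exp (Ioo_subset_Icc_self hx)).hasDerivAt (Icc_mem_nhds hx.1 hx.2)

lemma contDiffOn_logDerivUnit (hf : IsDiffTwoDelta f) :
    ContDiffOn ℝ 1 (logDerivUnit f) (Icc 0 1) :=
  (hf.contDiffOn.derivWithin (uniqueDiffOn_Icc zero_lt_one) (by norm_num)).log
    fun _ hx => (hf.derivWithin_pos hx).ne'

lemma continuousOn_logDerivUnit (hf : IsDiffTwoDelta f) :
    ContinuousOn (logDerivUnit f) (Icc 0 1) :=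
  hf.contDiffOn_logDerivUnit.continuousOn

lemma continuousOn (hf : IsDiffTwoDelta f) : ContinuousOn f (Icc 0 1) :=
  hf.contDiffOn.continuousOn

lemma exists_lipschitzOnWith (hf : IsDiffTwoDelta f) :
    ∃ K, LipschitzOnWith K (logDerivUnit f) (Icc 0 1) :=
  hf.contDiffOn_logDerivUnit.exists_lipschitzOnWith one_ne_zero (convex_Icc 0 1) isCompact_Icc

/-- The inverse of a diffeomorphism in the class is again in the class. -/
lemma exists_inv (hf : IsDiffTwoDelta f) :
    ∃ g, IsDiffTwoDelta g ∧ InvOn g f (Icc 0 1) (Icc 0 1) := by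
  obtain ⟨g, hg, hinv, hgc⟩ := hf.exists_inverse
  refine ⟨g, ⟨hg, ?_, hgc, ⟨f, hf.mapsTo, hinv.symm, hf.contDiffOn⟩, ?_⟩, hinv⟩
  · intro x hx y hy hxy
    by_contra! h
    have := hf.strictMonoOn.monotoneOn (hg hy) (hg hx) h
    rw [hinv.2 hx, hinv.2 hy] at this
    exact absurd this (not_le.2 hxy)
  · intro x hx h
    apply hf.no_fixed_point x hx
    nth_rw 1 [← h]
    exact hinv.2 (Ioo_subset_Icc_self hx)

lemma one_sub_mem_Icc (hx : x ∈ Icc (0 : ℝ) 1) : 1 - x ∈ Icc (0 : ℝ) 1 :=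
  ⟨by linarith [hx.2], by linarith [hx.1]⟩

/-- The class is stable under conjugation by the reflection `x ↦ 1 - x`. -/
lemma reflect (hf : IsDiffTwoDelta f) : IsDiffTwoDelta fun x => 1 - f (1 - x) := by
  obtain ⟨g, hg, hinv, hgc⟩ := hf.exists_inverse
  have hm : MapsTo (fun x : ℝ => 1 - x) (Icc 0 1) (Icc 0 1) := fun x hx => one_sub_mem_Icc hx
  have hc : ContDiffOn ℝ 2 (fun x : ℝ => 1 - x) (Icc 0 1) := by fun_prop
  refine ⟨fun x hx => hm (hf.mapsTo (hm hx)), ?_, contDiffOn_const.sub (hf.contDiffOn.comp hc hm),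
    ⟨fun x => 1 - g (1 - x), fun x hx => hm (hg (hm hx)), ⟨?_, ?_⟩,
    contDiffOn_const.sub (hgc.comp hc hm)⟩, ?_⟩
  · intro x hx y hy hxy
    have := hf.strictMonoOn (hm hy) (hm hx) (by simpa using hxy)
    simpa using this
  · intro x hx
    have := hinv.1 (hm hx)
    simp [this]
  · intro x hx
    have := hinv.2 (hm hx)
    simp [this]
  · intro x hx h
    have := hf.no_fixed_point (1 - x) ⟨by linarith [hx.2], by linarith [hx.1]⟩
    apply this
    linarith

lemma forall_lt_or_forall_gt (hf : IsDiffTwoDelta f) :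
    (∀ x ∈ Ioo (0 : ℝ) 1, f x < x) ∨ ∀ x ∈ Ioo (0 : ℝ) 1, x < f x := by
  by_contra! h
  obtain ⟨⟨x, hx, hfx⟩, y, hy, hfy⟩ := h
  obtain ⟨z, hz, hfz⟩ := (isPreconnected_Ioo (a := (0 : ℝ)) (b := 1)).intermediate_value₂ hy hx
    (hf.continuousOn.mono Ioo_subset_Icc_self) continuousOn_id hfy hfx
  exact hf.no_fixed_point z hz hfz

lemma inv_lt (hg : IsDiffTwoDelta g)
    (hinv : InvOn g f (Icc 0 1) (Icc 0 1)) (h : ∀ x ∈ Ioo (0 : ℝ) 1, x < f x) :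
    ∀ x ∈ Ioo (0 : ℝ) 1, g x < x := by
  intro x hx
  have := h (g x) (hg.mapsTo_Ioo hx)
  rwa [hinv.2 (Ioo_subset_Icc_self hx)] at this

lemma inv_gt (hg : IsDiffTwoDelta g)
    (hinv : InvOn g f (Icc 0 1) (Icc 0 1)) (h : ∀ x ∈ Ioo (0 : ℝ) 1, f x < x) :
    ∀ x ∈ Ioo (0 : ℝ) 1, x < g x := by
  intro x hx
  have := h (g x) (hg.mapsTo_Ioo hx)
  rwa [hinv.2 (Ioo_subset_Icc_self hx)] at this

lemma iterate_inv (hf : IsDiffTwoDelta f) (hinv : InvOn g f (Icc 0 1) (Icc 0 1)) (n : ℕ)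
    (hx : x ∈ Icc (0 : ℝ) 1) : g^[n] (f^[n] x) = x := by
  induction n with
  | zero => rfl
  | succ n ih =>
    rw [Function.iterate_succ_apply, Function.iterate_succ_apply', hinv.1 (hf.mapsTo.iterate n hx),
      ih]

lemma reflect_iterate (f : ℝ → ℝ) (n : ℕ) (x : ℝ) :
    (fun x => 1 - f (1 - x))^[n] x = 1 - f^[n] (1 - x) := by
  induction n with
  | zero => simp
  | succ n ih => rw [Function.iterate_succ_apply', ih, Function.iterate_succ_apply']; simp

lemma strictMonoOn_iterate (hf : IsDiffTwoDelta f) (n : ℕ) : StrictMonoOn f^[n] (Icc 0 1) := by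
  induction n with
  | zero => exact strictMonoOn_id
  | succ n ih =>
    rw [Function.iterate_succ']
    exact hf.strictMonoOn.comp ih (hf.mapsTo.iterate n)

lemma le_self (hf : IsDiffTwoDelta f) (h : ∀ x ∈ Ioo (0 : ℝ) 1, f x < x)
    (hx : x ∈ Icc (0 : ℝ) 1) : f x ≤ x := by
  rcases hx.1.eq_or_lt with rfl | h0
  · exact hf.map_zero.le
  rcases hx.2.eq_or_lt with rfl | h1
  · exact hf.map_one.le
  exact (h x ⟨h0, h1⟩).le

lemma antitone_iterate (hf : IsDiffTwoDelta f) (h : ∀ x ∈ Ioo (0 : ℝ) 1, f x < x)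
    (hx : x ∈ Icc (0 : ℝ) 1) : Antitone fun n => f^[n] x := by
  refine antitone_nat_of_succ_le fun n => ?_
  rw [Function.iterate_succ_apply']
  exact hf.le_self h (hf.mapsTo.iterate n hx)

/-- The orbits of a contraction converge to the fixed point `0`: the limit is a fixed point. -/
lemma tendsto_iterate (hf : IsDiffTwoDelta f) (h : ∀ x ∈ Ioo (0 : ℝ) 1, f x < x)
    (hx : x ∈ Ico (0 : ℝ) 1) : Tendsto (fun n => f^[n] x) atTop (𝓝 0) := by
  have hxI := Ico_subset_Icc_self hx
  have hanti := hf.antitone_iterate h hxI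
  have hbdd : BddBelow (range fun n => f^[n] x) :=
    ⟨0, by rintro _ ⟨n, rfl⟩; exact (hf.mapsTo.iterate n hxI).1⟩
  have hlim := tendsto_atTop_ciInf hanti hbdd
  set l := ⨅ n, f^[n] x
  have hl0 : 0 ≤ l := le_ciInf fun n => (hf.mapsTo.iterate n hxI).1
  have hl1 : l < 1 := (ciInf_le hbdd 0).trans_lt hx.2
  have hl : l ∈ Icc (0 : ℝ) 1 := ⟨hl0, hl1.le⟩
  have h1 : Tendsto (fun n => f (f^[n] x)) atTop (𝓝 (f l)) :=
    (hf.continuousOn l hl).tendsto.comp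
      (tendsto_nhdsWithin_iff.2 ⟨hlim, Eventually.of_forall fun n => hf.mapsTo.iterate n hxI⟩)
  have h2 : Tendsto (fun n => f (f^[n] x)) atTop (𝓝 l) := by
    have := (tendsto_add_atTop_iff_nat 1).2 hlim
    simpa only [Function.iterate_succ_apply'] using this
  have h3 := tendsto_nhds_unique h1 h2
  rcases hl0.eq_or_lt with h0 | h0
  · rwa [← h0] at hlim
  · exact absurd h3 (hf.no_fixed_point l ⟨h0, hl1⟩)

lemma hasDerivWithinAt_iterate (hf : IsDiffTwoDelta f) (n : ℕ) (hx : x ∈ Icc (0 : ℝ) 1) :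
    HasDerivWithinAt f^[n] (Real.exp (∑ i ∈ Finset.range n, logDerivUnit f (f^[i] x)))
      (Icc 0 1) x := by
  induction n with
  | zero => simpa using hasDerivWithinAt_id x _
  | succ n ih =>
    rw [Finset.sum_range_succ, Real.exp_add, mul_comm, Function.iterate_succ']
    exact (hf.hasDerivWithinAt_exp (hf.mapsTo.iterate n hx)).comp x ih (hf.mapsTo.iterate n)

lemma hasDerivAt_iterate (hf : IsDiffTwoDelta f) (n : ℕ) (hx : x ∈ Ioo (0 : ℝ) 1) :
    HasDerivAt f^[n] (Real.exp (∑ i ∈ Finset.range n, logDerivUnit f (f^[i] x))) x :=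
  (hf.hasDerivWithinAt_iterate n (Ioo_subset_Icc_self hx)).hasDerivAt (Icc_mem_nhds hx.1 hx.2)

lemma logDerivUnit_iterate (hf : IsDiffTwoDelta f) (n : ℕ) (hx : x ∈ Icc (0 : ℝ) 1) :
    logDerivUnit f^[n] x = ∑ i ∈ Finset.range n, logDerivUnit f (f^[i] x) := by
  rw [logDerivUnit, (hf.hasDerivWithinAt_iterate n hx).derivWithin
    (uniqueDiffOn_Icc zero_lt_one x hx), Real.log_exp]

lemma logDerivUnit_inv (hf : IsDiffTwoDelta f) (hg : IsDiffTwoDelta g)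
    (hinv : InvOn g f (Icc 0 1) (Icc 0 1)) (hx : x ∈ Icc (0 : ℝ) 1) :
    logDerivUnit f x = - logDerivUnit g (f x) := by
  have h3 : HasDerivWithinAt (g ∘ f) _ (Icc 0 1) x :=
    (hg.hasDerivWithinAt_exp (hf.mapsTo hx)).comp x (hf.hasDerivWithinAt_exp hx) hf.mapsTo
  have h4 : HasDerivWithinAt (g ∘ f) 1 (Icc 0 1) x :=
    (hasDerivWithinAt_id x _).congr (fun y hy => hinv.1 hy) (hinv.1 hx)
  have h5 := (uniqueDiffOn_Icc zero_lt_one x hx).eq_deriv _ h3 h4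
  rw [← Real.exp_add, Real.exp_eq_one_iff] at h5
  linarith

lemma logDerivUnit_reflect (hf : IsDiffTwoDelta f) (hx : x ∈ Icc (0 : ℝ) 1) :
    logDerivUnit (fun x => 1 - f (1 - x)) x = logDerivUnit f (1 - x) := by
  have hm : MapsTo (fun x : ℝ => 1 - x) (Icc 0 1) (Icc 0 1) := fun x hx => one_sub_mem_Icc hx
  have h1 : HasDerivWithinAt (fun x : ℝ => 1 - x) (-1) (Icc 0 1) x := by
    simpa using (hasDerivWithinAt_id x (Icc (0 : ℝ) 1)).const_sub 1
  have h2 := ((hf.hasDerivWithinAt_exp (hm hx)).comp x h1 hm).const_sub 1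
  have h3 := h2.derivWithin (uniqueDiffOn_Icc zero_lt_one x hx)
  simp only [mul_neg, mul_one, neg_neg] at h3
  rw [logDerivUnit]
  erw [h3]
  rw [Real.log_exp]

end IsDiffTwoDelta

/-! ### Bounded distortion and the limit field of a contraction -/

/-- A function on `[0,1)` whose derivative on `(0,1)` extends continuously to `[0,1)` is `C^1`. -/
lemma contDiffOn_one_Ico_of_hasDerivAt {V Z : ℝ → ℝ} (hV : ContinuousOn V (Ico 0 1))
    (hZ : ContinuousOn Z (Ico 0 1)) (hVZ : ∀ x ∈ Ioo (0 : ℝ) 1, HasDerivAt V (Z x) x) :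
    ContDiffOn ℝ 1 V (Ico 0 1) := by
  have hderiv : ∀ x ∈ Ico (0 : ℝ) 1, HasDerivWithinAt V (Z x) (Ico 0 1) x := by
    intro x hx
    rcases hx.1.eq_or_lt with rfl | h0
    · have hlim : Tendsto (fun x => deriv V x) (𝓝[>] 0) (𝓝 (Z 0)) := by
        have h1 : Tendsto Z (𝓝[>] 0) (𝓝 (Z 0)) := by
          have := (hZ 0 hx).mono_left (nhdsWithin_mono 0 Ioo_subset_Ico_self)
          rwa [nhdsWithin_Ioo_eq_nhdsGT zero_lt_one] at this
        refine h1.congr' ?_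
        filter_upwards [Ioo_mem_nhdsGT (zero_lt_one' ℝ)] with y hy
        exact (hVZ y hy).deriv.symm
      have := hasDerivWithinAt_Ici_of_tendsto_deriv (s := Ioo (0 : ℝ) 1)
        (fun y hy => (hVZ y hy).differentiableAt.differentiableWithinAt)
        ((hV 0 hx).mono Ioo_subset_Ico_self) (Ioo_mem_nhdsGT zero_lt_one) hlim
      exact this.mono Ico_subset_Ici_self
    · exact (hVZ x ⟨h0, hx.2⟩).hasDerivWithinAt
  rw [show (1 : WithTop ℕ∞) = 0 + 1 from rfl,
    contDiffOn_succ_iff_derivWithin (uniqueDiffOn_Ico (0 : ℝ) 1)]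
  refine ⟨fun x hx => (hderiv x hx).differentiableWithinAt, by simp, ?_⟩
  rw [contDiffOn_zero]
  exact hZ.congr fun x hx => (hderiv x hx).derivWithin (uniqueDiffOn_Ico (0 : ℝ) 1 x hx)

/-- The `n`-th approximation of (minus) the Szekeres vector field of a contraction `f`: the
pullback by `f^n` of the vector field `x ↦ x - f x`. -/
noncomputable def szekeresApprox (f : ℝ → ℝ) (n : ℕ) (x : ℝ) : ℝ :=
  (f^[n] x - f^[n + 1] x) * Real.exp (-∑ i ∈ Finset.range n, logDerivUnit f (f^[i] x))

namespace IsDiffTwoDelta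

variable {f : ℝ → ℝ} {K : NNReal} {x : ℝ}

/-- Bounded distortion of one step, from the mean value theorem. -/
lemma sub_map_bounds (hf : IsDiffTwoDelta f) (h : ∀ x ∈ Ioo (0 : ℝ) 1, f x < x)
    (hK : LipschitzOnWith K (logDerivUnit f) (Icc 0 1)) (hx : x ∈ Icc (0 : ℝ) 1) :
    (x - f x) * Real.exp (logDerivUnit f x - K * (x - f x)) ≤ f x - f (f x) ∧
      f x - f (f x) ≤ (x - f x) * Real.exp (logDerivUnit f x + K * (x - f x)) := by
  rcases (hf.le_self h hx).eq_or_lt with h0 | h0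
  · simp [h0]
  have hfx := hf.mapsTo hx
  obtain ⟨ξ, hξ, hslope⟩ := exists_hasDerivAt_eq_slope f
    (fun x => Real.exp (logDerivUnit f x)) h0
    (hf.continuousOn.mono (Icc_subset_Icc hfx.1 hx.2))
    (fun y hy => hf.hasDerivAt_exp ⟨hfx.1.trans_lt hy.1, hy.2.trans_le hx.2⟩)
  have hpos : 0 < x - f x := sub_pos.2 h0
  have heq : f x - f (f x) = (x - f x) * Real.exp (logDerivUnit f ξ) := by
    rw [hslope]; field_simp
  have hdist := hK.dist_le_mul x hx ξ ⟨hfx.1.trans hξ.1.le, hξ.2.le.trans hx.2⟩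
  rw [Real.dist_eq, Real.dist_eq, abs_of_pos (sub_pos.2 hξ.2)] at hdist
  have hle : K * (x - ξ) ≤ K * (x - f x) :=
    mul_le_mul_of_nonneg_left (by linarith [hξ.1]) K.coe_nonneg
  have habs := abs_le.1 (hdist.trans hle)
  rw [heq]
  constructor <;> refine mul_le_mul_of_nonneg_left (Real.exp_le_exp.2 ?_) hpos.le
  · linarith [habs.2]
  · linarith [habs.1]

lemma szekeresApprox_nonneg (hf : IsDiffTwoDelta f) (h : ∀ x ∈ Ioo (0 : ℝ) 1, f x < x) (n : ℕ)
    (hx : x ∈ Icc (0 : ℝ) 1) : 0 ≤ szekeresApprox f n x :=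
  mul_nonneg (sub_nonneg.2 (hf.antitone_iterate h hx n.le_succ)) (Real.exp_pos _).le

lemma szekeresApprox_succ_bounds (hf : IsDiffTwoDelta f) (h : ∀ x ∈ Ioo (0 : ℝ) 1, f x < x)
    (hK : LipschitzOnWith K (logDerivUnit f) (Icc 0 1)) (n : ℕ) (hx : x ∈ Icc (0 : ℝ) 1) :
    szekeresApprox f n x * Real.exp (-(K * f^[n] x)) ≤
        szekeresApprox f (n + 1) x * Real.exp (-(K * f^[n + 1] x)) ∧
      szekeresApprox f (n + 1) x * Real.exp (K * f^[n + 1] x) ≤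
        szekeresApprox f n x * Real.exp (K * f^[n] x) := by
  have hb := hf.sub_map_bounds h hK (hf.mapsTo.iterate n hx)
  simp only [szekeresApprox, Finset.sum_range_succ, Function.iterate_succ_apply' f]
  set p := f^[n] x
  set E := ∑ i ∈ Finset.range n, logDerivUnit f (f^[i] x)
  constructor
  · have := mul_le_mul_of_nonneg_right hb.1
      (Real.exp_pos (-(E + logDerivUnit f p) + -(K * f p))).le
    rw [mul_assoc, ← Real.exp_add] at this
    rw [mul_assoc, mul_assoc, ← Real.exp_add, ← Real.exp_add]
    refine le_trans (le_of_eq ?_) this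
    ring_nf
  · have := mul_le_mul_of_nonneg_right hb.2
      (Real.exp_pos (-(E + logDerivUnit f p) + K * f p)).le
    rw [mul_assoc _ _ (Real.exp (-(E + logDerivUnit f p) + K * f p)), ← Real.exp_add] at this
    rw [mul_assoc, mul_assoc, ← Real.exp_add, ← Real.exp_add]
    refine this.trans (le_of_eq ?_)
    ring_nf

/-- `V` is the limit of the approximations, in the form of two-sided bounds: `V` lies between an
increasing and a decreasing sequence, `K` being a Lipschitz constant of `log Df`. -/
def IsSzekeresLimit (f : ℝ → ℝ) (K : NNReal) (V : ℝ → ℝ) : Prop :=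
  ∀ x ∈ Icc (0 : ℝ) 1, ∀ n,
    szekeresApprox f n x * Real.exp (-(K * f^[n] x)) ≤ V x ∧
      V x ≤ szekeresApprox f n x * Real.exp (K * f^[n] x)

/-- The approximations converge, the limit being pinched between two monotone sequences. -/
lemma exists_szekeres_limit (hf : IsDiffTwoDelta f) (h : ∀ x ∈ Ioo (0 : ℝ) 1, f x < x)
    (hK : LipschitzOnWith K (logDerivUnit f) (Icc 0 1)) :
    ∃ V : ℝ → ℝ, IsSzekeresLimit f K V := by
  refine ⟨fun x => ⨆ n, szekeresApprox f n x * Real.exp (-(K * f^[n] x)), fun x hx n => ?_⟩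
  have hmono : Monotone fun n => szekeresApprox f n x * Real.exp (-(K * f^[n] x)) :=
    monotone_nat_of_le_succ fun n => (hf.szekeresApprox_succ_bounds h hK n hx).1
  have hanti : Antitone fun n => szekeresApprox f n x * Real.exp (K * f^[n] x) :=
    antitone_nat_of_succ_le fun n => (hf.szekeresApprox_succ_bounds h hK n hx).2
  have hle : ∀ m n, szekeresApprox f m x * Real.exp (-(K * f^[m] x)) ≤
      szekeresApprox f n x * Real.exp (K * f^[n] x) := by
    intro m n
    refine (hmono (le_max_left m n)).trans (le_trans ?_ (hanti (le_max_right m n)))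
    refine mul_le_mul_of_nonneg_left (Real.exp_le_exp.2 ?_) (hf.szekeresApprox_nonneg h _ hx)
    have := mul_nonneg K.coe_nonneg (hf.mapsTo.iterate (max m n) hx).1
    linarith
  exact ⟨le_ciSup (f := fun n => szekeresApprox f n x * Real.exp (-(K * f^[n] x)))
    ⟨_, by rintro _ ⟨m, rfl⟩; exact hle m 0⟩ n, ciSup_le fun m => hle m n⟩

/-- Locally uniform convergence on `[0,1)` at a speed governed by the orbits of a contraction. -/
lemma tendstoLocallyUniformlyOn_of_le (hf : IsDiffTwoDelta f)
    (h : ∀ x ∈ Ioo (0 : ℝ) 1, f x < x) {F : ℕ → ℝ → ℝ} {G : ℝ → ℝ} {C : ℝ} (hC : 0 ≤ C)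
    (hFG : ∀ x ∈ Ico (0 : ℝ) 1, ∀ n, |F n x - G x| ≤ C * f^[n] x) :
    TendstoLocallyUniformlyOn F G atTop (Ico 0 1) := by
  rw [Metric.tendstoLocallyUniformlyOn_iff]
  intro ε hε x hx
  obtain ⟨c, hxc, hc1⟩ := exists_between hx.2
  have hc : c ∈ Ico (0 : ℝ) 1 := ⟨hx.1.trans hxc.le, hc1⟩
  refine ⟨Ico 0 1 ∩ Iio c, inter_mem self_mem_nhdsWithin
    (mem_nhdsWithin_of_mem_nhds (Iio_mem_nhds hxc)), ?_⟩
  have hlim : Tendsto (fun n => C * f^[n] c) atTop (𝓝 0) := by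
    simpa using (hf.tendsto_iterate h hc).const_mul C
  filter_upwards [hlim.eventually (gt_mem_nhds hε)] with n hn y hy
  rw [dist_comm, Real.dist_eq]
  refine (hFG y hy.1 n).trans_lt (lt_of_le_of_lt (mul_le_mul_of_nonneg_left ?_ hC) hn)
  exact hf.strictMonoOn_iterate n |>.monotoneOn (Ico_subset_Icc_self hy.1)
    (Ico_subset_Icc_self hc) hy.2.le

end IsDiffTwoDelta

/-! ### Regularity and invariance of the limit field -/

namespace IsDiffTwoDelta

variable {f V : ℝ → ℝ} {K : NNReal} {x : ℝ}

lemma szekeresApprox_zero (f : ℝ → ℝ) (x : ℝ) : szekeresApprox f 0 x = x - f x := by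
  simp [szekeresApprox]

lemma szekeresApprox_map (f : ℝ → ℝ) (n : ℕ) (x : ℝ) :
    szekeresApprox f n (f x) = Real.exp (logDerivUnit f x) * szekeresApprox f (n + 1) x := by
  simp only [szekeresApprox, Finset.sum_range_succ', Function.iterate_succ_apply,
    Function.iterate_zero, id]
  rw [neg_add, Real.exp_add, mul_left_comm, mul_left_comm (Real.exp _),
    Real.exp_neg (logDerivUnit f x),
    mul_inv_cancel₀ (Real.exp_pos _).ne', mul_one]

lemma szekeres_nonneg (hf : IsDiffTwoDelta f) (h : ∀ x ∈ Ioo (0 : ℝ) 1, f x < x)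
    (hV : IsSzekeresLimit f K V) (hx : x ∈ Icc (0 : ℝ) 1) : 0 ≤ V x :=
  (mul_nonneg (hf.szekeresApprox_nonneg h 0 hx) (Real.exp_pos _).le).trans (hV x hx 0).1

lemma szekeres_pos (h : ∀ x ∈ Ioo (0 : ℝ) 1, f x < x)
    (hV : IsSzekeresLimit f K V) (hx : x ∈ Ioo (0 : ℝ) 1) : 0 < V x := by
  refine lt_of_lt_of_le (mul_pos ?_ (Real.exp_pos _)) (hV x (Ioo_subset_Icc_self hx) 0).1
  rw [szekeresApprox_zero]
  exact sub_pos.2 (h x hx)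

lemma szekeres_le (hf : IsDiffTwoDelta f) (h : ∀ x ∈ Ioo (0 : ℝ) 1, f x < x)
    (hV : IsSzekeresLimit f K V) (hx : x ∈ Icc (0 : ℝ) 1) : V x ≤ (x - f x) * Real.exp K := by
  refine (hV x hx 0).2.trans ?_
  rw [szekeresApprox_zero]
  refine mul_le_mul_of_nonneg_left (Real.exp_le_exp.2 ?_) (sub_nonneg.2 (hf.le_self h hx))
  exact mul_le_of_le_one_right K.coe_nonneg hx.2

lemma szekeres_map_zero (hf : IsDiffTwoDelta f) (h : ∀ x ∈ Ioo (0 : ℝ) 1, f x < x)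
    (hV : IsSzekeresLimit f K V) : V 0 = 0 := by
  have h0 : (0 : ℝ) ∈ Icc (0 : ℝ) 1 := left_mem_Icc.2 zero_le_one
  refine le_antisymm ?_ (hf.szekeres_nonneg h hV h0)
  simpa [hf.map_zero] using hf.szekeres_le h hV h0

lemma abs_szekeresApprox_sub_le (hf : IsDiffTwoDelta f) (h : ∀ x ∈ Ioo (0 : ℝ) 1, f x < x)
    (hV : IsSzekeresLimit f K V) (hx : x ∈ Icc (0 : ℝ) 1) (n : ℕ) :
    |szekeresApprox f n x - V x| ≤ V x * (K * Real.exp K * f^[n] x) := by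
  obtain ⟨h1, h2⟩ := hV x hx n
  have hp := hf.mapsTo.iterate n hx
  have hV0 := hf.szekeres_nonneg h hV hx
  set u : ℝ := K * f^[n] x with hu
  have hu0 : 0 ≤ u := mul_nonneg K.coe_nonneg hp.1
  have huK : u ≤ K := mul_le_of_le_one_right K.coe_nonneg hp.2
  have h3 : szekeresApprox f n x ≤ V x * Real.exp u := by
    have := mul_le_mul_of_nonneg_right h1 (Real.exp_pos u).le
    rwa [mul_assoc, ← Real.exp_add, neg_add_cancel, Real.exp_zero, mul_one] at this
  have h4 : V x * Real.exp (-u) ≤ szekeresApprox f n x := by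
    have := mul_le_mul_of_nonneg_right h2 (Real.exp_pos (-u)).le
    rwa [mul_assoc, ← Real.exp_add, add_neg_cancel, Real.exp_zero, mul_one] at this
  have h5 : 1 - u ≤ Real.exp (-u) := by linarith [Real.add_one_le_exp (-u)]
  have h6 : Real.exp u - 1 ≤ u * Real.exp u := by
    have := mul_le_mul_of_nonneg_right h5 (Real.exp_pos u).le
    rw [← Real.exp_add, neg_add_cancel, Real.exp_zero] at this
    linarith
  have h7 : u * Real.exp u ≤ u * Real.exp K :=
    mul_le_mul_of_nonneg_left (Real.exp_le_exp.2 huK) hu0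
  have h8 : u ≤ u * Real.exp K := le_mul_of_one_le_right hu0 (Real.one_le_exp K.coe_nonneg)
  have h9 : V x * (K * Real.exp K * f^[n] x) = V x * (u * Real.exp K) := by rw [hu]; ring
  rw [h9, abs_le]
  constructor
  · have := mul_le_mul_of_nonneg_left (h8.trans' (by linarith : 1 - Real.exp (-u) ≤ u)) hV0
    linarith
  · have := mul_le_mul_of_nonneg_left (h6.trans h7) hV0
    linarith

lemma tendsto_szekeresApprox (hf : IsDiffTwoDelta f) (h : ∀ x ∈ Ioo (0 : ℝ) 1, f x < x)
    (hV : IsSzekeresLimit f K V) (hx : x ∈ Ico (0 : ℝ) 1) :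
    Tendsto (fun n => szekeresApprox f n x) atTop (𝓝 (V x)) := by
  rw [tendsto_iff_dist_tendsto_zero]
  refine squeeze_zero (fun _ => dist_nonneg)
    (fun n => hf.abs_szekeresApprox_sub_le h hV (Ico_subset_Icc_self hx) n) ?_
  simpa using ((hf.tendsto_iterate h hx).const_mul (K * Real.exp K)).const_mul (V x)

/-- The limit is invariant under `f` as a vector field. -/
lemma szekeres_map (hf : IsDiffTwoDelta f) (h : ∀ x ∈ Ioo (0 : ℝ) 1, f x < x)
    (hV : IsSzekeresLimit f K V) (hx : x ∈ Ico (0 : ℝ) 1) :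
    V (f x) = Real.exp (logDerivUnit f x) * V x := by
  refine tendsto_nhds_unique (hf.tendsto_szekeresApprox h hV (hf.mapsTo_Ico hx)) ?_
  simp only [szekeresApprox_map]
  exact ((tendsto_add_atTop_iff_nat 1).2 (hf.tendsto_szekeresApprox h hV hx)).const_mul _

lemma szekeres_iterate (hf : IsDiffTwoDelta f) (h : ∀ x ∈ Ioo (0 : ℝ) 1, f x < x)
    (hV : IsSzekeresLimit f K V) (hx : x ∈ Ico (0 : ℝ) 1) (n : ℕ) :
    V (f^[n] x) = Real.exp (∑ i ∈ Finset.range n, logDerivUnit f (f^[i] x)) * V x := by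
  induction n with
  | zero => simp
  | succ n ih =>
    rw [Function.iterate_succ_apply', hf.szekeres_map h hV (hf.mapsTo_Ico.iterate n hx), ih,
      Finset.sum_range_succ, Real.exp_add]
    ring

/-- The derivative of `log Df` on `[0,1]`. -/
noncomputable def nonlinearity (f : ℝ → ℝ) (x : ℝ) : ℝ :=
  derivWithin (logDerivUnit f) (Icc 0 1) x

lemma continuousOn_nonlinearity (hf : IsDiffTwoDelta f) :
    ContinuousOn (nonlinearity f) (Icc 0 1) :=
  hf.contDiffOn_logDerivUnit.continuousOn_derivWithin (uniqueDiffOn_Icc zero_lt_one) le_rfl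

lemma abs_nonlinearity_le (hf : IsDiffTwoDelta f)
    (hK : LipschitzOnWith K (logDerivUnit f) (Icc 0 1)) (hx : x ∈ Icc (0 : ℝ) 1) :
    |nonlinearity f x| ≤ K := by
  have h1 : HasDerivWithinAt (logDerivUnit f) (nonlinearity f x) (Icc 0 1) x :=
    ((hf.contDiffOn_logDerivUnit.differentiableOn one_ne_zero) x hx).hasDerivWithinAt
  have h2 := (hasDerivWithinAt_iff_tendsto_slope.1 h1).abs
  have h3 : (𝓝[Icc (0 : ℝ) 1 \ {x}] x).NeBot := by
    rw [← accPt_principal_iff_nhdsWithin]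
    exact uniqueDiffWithinAt_iff_accPt.1 (uniqueDiffOn_Icc zero_lt_one x hx)
  refine le_of_tendsto h2 ?_
  filter_upwards [self_mem_nhdsWithin] with y hy
  have h4 := hK.dist_le_mul y hy.1 x hx
  rw [Real.dist_eq, Real.dist_eq] at h4
  rw [slope_def_field, abs_div, div_le_iff₀ (abs_pos.2 (sub_ne_zero.2 hy.2))]
  exact h4

lemma hasDerivAt_logDerivUnit (hf : IsDiffTwoDelta f) (hx : x ∈ Ioo (0 : ℝ) 1) :
    HasDerivAt (logDerivUnit f) (nonlinearity f x) x :=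
  ((hf.contDiffOn_logDerivUnit.differentiableOn one_ne_zero) x
    (Ioo_subset_Icc_self hx)).hasDerivWithinAt.hasDerivAt (Icc_mem_nhds hx.1 hx.2)

/-- The derivative of `szekeresApprox f n`, given by a formula that makes sense and is continuous up
to the endpoints. -/
noncomputable def szekeresApproxDeriv (f : ℝ → ℝ) (n : ℕ) (x : ℝ) : ℝ :=
  1 - Real.exp (logDerivUnit f (f^[n] x)) - ∑ i ∈ Finset.range n, nonlinearity f (f^[i] x) *
    (Real.exp (∑ j ∈ Finset.range i, logDerivUnit f (f^[j] x)) * szekeresApprox f n x)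

lemma mapsTo_iterate_Ioo (hf : IsDiffTwoDelta f) (n : ℕ) : MapsTo f^[n] (Ioo 0 1) (Ioo 0 1) :=
  hf.mapsTo_Ioo.iterate n

lemma hasDerivAt_szekeresApprox (hf : IsDiffTwoDelta f) (n : ℕ) (hx : x ∈ Ioo (0 : ℝ) 1) :
    HasDerivAt (szekeresApprox f n) (szekeresApproxDeriv f n x) x := by
  have h1 := (hf.hasDerivAt_iterate n hx).sub (hf.hasDerivAt_iterate (n + 1) hx)
  have h2 : HasDerivAt (fun x => ∑ i ∈ Finset.range n, logDerivUnit f (f^[i] x))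
      (∑ i ∈ Finset.range n, nonlinearity f (f^[i] x) *
        Real.exp (∑ j ∈ Finset.range i, logDerivUnit f (f^[j] x))) x :=
    HasDerivAt.fun_sum fun i _ =>
      (hf.hasDerivAt_logDerivUnit (hf.mapsTo_iterate_Ioo i hx)).comp x (hf.hasDerivAt_iterate i hx)
  have h3 : HasDerivAt (fun x => -∑ i ∈ Finset.range n, logDerivUnit f (f^[i] x)) _ x := h2.neg
  refine (h1.mul h3.exp).congr_deriv ?_
  rw [Finset.sum_range_succ, Real.exp_add, szekeresApproxDeriv]
  simp only [← mul_assoc, ← Finset.sum_mul]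
  simp only [szekeresApprox, Pi.sub_apply, Real.exp_neg]
  field_simp
  ring

lemma continuousOn_iterate (hf : IsDiffTwoDelta f) (n : ℕ) : ContinuousOn f^[n] (Icc 0 1) :=
  hf.continuousOn.iterate hf.mapsTo n

lemma continuousOn_sum_logDerivUnit (hf : IsDiffTwoDelta f) (n : ℕ) :
    ContinuousOn (fun x => ∑ i ∈ Finset.range n, logDerivUnit f (f^[i] x)) (Icc 0 1) :=
  continuousOn_finsetSum _ fun i _ =>
    hf.continuousOn_logDerivUnit.comp (hf.continuousOn_iterate i) (hf.mapsTo.iterate i)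

lemma continuousOn_szekeresApprox (hf : IsDiffTwoDelta f) (n : ℕ) :
    ContinuousOn (szekeresApprox f n) (Icc 0 1) :=
  ((hf.continuousOn_iterate n).sub (hf.continuousOn_iterate (n + 1))).mul
    (hf.continuousOn_sum_logDerivUnit n).neg.rexp

lemma continuousOn_szekeresApproxDeriv (hf : IsDiffTwoDelta f) (n : ℕ) :
    ContinuousOn (szekeresApproxDeriv f n) (Icc 0 1) :=
  (continuousOn_const.sub (hf.continuousOn_logDerivUnit.comp (hf.continuousOn_iterate n)
    (hf.mapsTo.iterate n)).rexp).sub <| continuousOn_finsetSum _ fun i _ =>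
      (hf.continuousOn_nonlinearity.comp (hf.continuousOn_iterate i) (hf.mapsTo.iterate i)).mul
        ((hf.continuousOn_sum_logDerivUnit i).rexp.mul (hf.continuousOn_szekeresApprox n))

/-- The derivative of the limit of `szekeresApprox f n`. -/
noncomputable def szekeresDeriv (f V : ℝ → ℝ) (x : ℝ) : ℝ :=
  1 - Real.exp (logDerivUnit f 0) - ∑' i, nonlinearity f (f^[i] x) * V (f^[i] x)

lemma abs_nonlinearity_mul_le (hf : IsDiffTwoDelta f) (h : ∀ x ∈ Ioo (0 : ℝ) 1, f x < x)
    (hK : LipschitzOnWith K (logDerivUnit f) (Icc 0 1)) (hV : IsSzekeresLimit f K V)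
    (hx : x ∈ Icc (0 : ℝ) 1) :
    |nonlinearity f x * V x| ≤ K * Real.exp K * (x - f x) := by
  rw [abs_mul, abs_of_nonneg (hf.szekeres_nonneg h hV hx)]
  calc _ ≤ K * ((x - f x) * Real.exp K) :=
        mul_le_mul (hf.abs_nonlinearity_le hK hx) (hf.szekeres_le h hV hx)
          (hf.szekeres_nonneg h hV hx) K.coe_nonneg
    _ = _ := by ring

/-- The terms are dominated by the lengths of the successive steps of an orbit, which add up to at
most the starting point. -/
lemma sum_abs_nonlinearity_mul_le (hf : IsDiffTwoDelta f) (h : ∀ x ∈ Ioo (0 : ℝ) 1, f x < x)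
    (hK : LipschitzOnWith K (logDerivUnit f) (Icc 0 1)) (hV : IsSzekeresLimit f K V)
    (hx : x ∈ Icc (0 : ℝ) 1) (n : ℕ) :
    ∑ i ∈ Finset.range n, |nonlinearity f (f^[i] x) * V (f^[i] x)| ≤ K * Real.exp K * x := by
  calc _ ≤ ∑ i ∈ Finset.range n, K * Real.exp K * (f^[i] x - f^[i + 1] x) := by
        refine Finset.sum_le_sum fun i _ => ?_
        rw [Function.iterate_succ_apply']
        exact hf.abs_nonlinearity_mul_le h hK hV (hf.mapsTo.iterate i hx)
    _ = K * Real.exp K * (x - f^[n] x) := by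
        rw [← Finset.mul_sum, Finset.sum_range_sub' (fun i => f^[i] x)]; rfl
    _ ≤ _ := by
        refine mul_le_mul_of_nonneg_left ?_ (mul_nonneg K.coe_nonneg (Real.exp_pos _).le)
        linarith [(hf.mapsTo.iterate n hx).1]

lemma summable_nonlinearity_mul (hf : IsDiffTwoDelta f) (h : ∀ x ∈ Ioo (0 : ℝ) 1, f x < x)
    (hK : LipschitzOnWith K (logDerivUnit f) (Icc 0 1)) (hV : IsSzekeresLimit f K V)
    (hx : x ∈ Icc (0 : ℝ) 1) :
    Summable fun i => |nonlinearity f (f^[i] x) * V (f^[i] x)| :=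
  summable_of_sum_range_le (fun _ => abs_nonneg _)
    (hf.sum_abs_nonlinearity_mul_le h hK hV hx)

lemma abs_tsum_nonlinearity_mul_le (hf : IsDiffTwoDelta f) (h : ∀ x ∈ Ioo (0 : ℝ) 1, f x < x)
    (hK : LipschitzOnWith K (logDerivUnit f) (Icc 0 1)) (hV : IsSzekeresLimit f K V)
    (hx : x ∈ Icc (0 : ℝ) 1) :
    |∑' i, nonlinearity f (f^[i] x) * V (f^[i] x)| ≤ K * Real.exp K * x := by
  have hs := hf.summable_nonlinearity_mul h hK hV hx
  exact tsum_of_norm_bounded (f := fun i => nonlinearity f (f^[i] x) * V (f^[i] x))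
    hs.hasSum (fun i => le_rfl) |>.trans <| Real.tsum_le_of_sum_range_le (fun _ => abs_nonneg _)
      (hf.sum_abs_nonlinearity_mul_le h hK hV hx)

/-- The derivatives of the approximations converge, at a speed governed by the orbits. -/
lemma abs_szekeresApproxDeriv_sub_le (hf : IsDiffTwoDelta f) (h : ∀ x ∈ Ioo (0 : ℝ) 1, f x < x)
    (hK : LipschitzOnWith K (logDerivUnit f) (Icc 0 1)) (hV : IsSzekeresLimit f K V)
    {L : NNReal} (hL : LipschitzOnWith L (fun x => Real.exp (logDerivUnit f x)) (Icc 0 1))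
    (hx : x ∈ Ico (0 : ℝ) 1) (n : ℕ) :
    |szekeresApproxDeriv f n x - szekeresDeriv f V x| ≤
      (L + K * Real.exp K * (K * Real.exp K) + K * Real.exp K) * f^[n] x := by
  have hxI := Ico_subset_Icc_self hx
  have hp := hf.mapsTo.iterate n hxI
  have hKK : 0 ≤ K * Real.exp K := mul_nonneg K.coe_nonneg (Real.exp_pos _).le
  have h1 : |Real.exp (logDerivUnit f 0) - Real.exp (logDerivUnit f (f^[n] x))| ≤
      L * f^[n] x := by
    have := hL.dist_le_mul 0 (left_mem_Icc.2 zero_le_one) _ hp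
    rwa [Real.dist_eq, Real.dist_eq, zero_sub, abs_neg, abs_of_nonneg hp.1] at this
  have h2 : |∑ i ∈ Finset.range n, nonlinearity f (f^[i] x) * V (f^[i] x) -
      ∑ i ∈ Finset.range n, nonlinearity f (f^[i] x) *
        (Real.exp (∑ j ∈ Finset.range i, logDerivUnit f (f^[j] x)) * szekeresApprox f n x)| ≤
      K * Real.exp K * (K * Real.exp K) * f^[n] x := by
    rw [← Finset.sum_sub_distrib]
    refine (Finset.abs_sum_le_sum_abs _ _).trans ?_
    have hterm : ∀ i ∈ Finset.range n, |nonlinearity f (f^[i] x) * V (f^[i] x) -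
        nonlinearity f (f^[i] x) *
        (Real.exp (∑ j ∈ Finset.range i, logDerivUnit f (f^[j] x)) * szekeresApprox f n x)| ≤
        |nonlinearity f (f^[i] x) * V (f^[i] x)| * (K * Real.exp K * f^[n] x) := by
      intro i _
      rw [hf.szekeres_iterate h hV hx, ← mul_sub, ← mul_sub, abs_mul, abs_mul, abs_mul, abs_mul,
        abs_sub_comm, abs_of_nonneg (hf.szekeres_nonneg h hV hxI), mul_assoc, mul_assoc]
      exact mul_le_mul_of_nonneg_left (mul_le_mul_of_nonneg_left
        (hf.abs_szekeresApprox_sub_le h hV hxI n) (abs_nonneg _)) (abs_nonneg _)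
    refine (Finset.sum_le_sum hterm).trans ?_
    rw [← Finset.sum_mul, ← mul_assoc]
    refine mul_le_mul_of_nonneg_right (mul_le_mul_of_nonneg_right ?_ hKK) hp.1
    exact (hf.sum_abs_nonlinearity_mul_le h hK hV hxI n).trans
      (mul_le_of_le_one_right hKK hxI.2)
  have h3 := hf.abs_tsum_nonlinearity_mul_le h hK hV hp
  simp only [← Function.iterate_add_apply] at h3
  have h4 := (hf.summable_nonlinearity_mul h hK hV hxI).of_abs.sum_add_tsum_nat_add n
  have h5 : szekeresApproxDeriv f n x - szekeresDeriv f V x =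
      (Real.exp (logDerivUnit f 0) - Real.exp (logDerivUnit f (f^[n] x))) +
      (∑ i ∈ Finset.range n, nonlinearity f (f^[i] x) * V (f^[i] x) -
      ∑ i ∈ Finset.range n, nonlinearity f (f^[i] x) *
        (Real.exp (∑ j ∈ Finset.range i, logDerivUnit f (f^[j] x)) * szekeresApprox f n x)) +
      ∑' i, nonlinearity f (f^[i + n] x) * V (f^[i + n] x) := by
    rw [szekeresApproxDeriv, szekeresDeriv, ← h4]
    ring
  rw [h5]
  refine (abs_add_three _ _ _).trans ?_
  linarith

/-- A contraction `f` preserves a `C^1` vector field on `[0,1)` that is positive on `(0,1)`. -/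
lemma exists_invariant_field (hf : IsDiffTwoDelta f) (h : ∀ x ∈ Ioo (0 : ℝ) 1, f x < x) :
    ∃ V : ℝ → ℝ, ContDiffOn ℝ 1 V (Ico 0 1) ∧ V 0 = 0 ∧ (∀ x ∈ Ioo (0 : ℝ) 1, 0 < V x) ∧
      ∀ x ∈ Ico (0 : ℝ) 1, V (f x) = Real.exp (logDerivUnit f x) * V x := by
  obtain ⟨K, hK⟩ := hf.exists_lipschitzOnWith
  obtain ⟨L, hL⟩ := (hf.contDiffOn_logDerivUnit.exp).exists_lipschitzOnWith one_ne_zero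
    (convex_Icc 0 1) isCompact_Icc
  obtain ⟨V, hV⟩ := hf.exists_szekeres_limit h hK
  have hKK : 0 ≤ K * Real.exp K := mul_nonneg K.coe_nonneg (Real.exp_pos _).le
  have hV1 : TendstoLocallyUniformlyOn (szekeresApprox f) V atTop (Ico 0 1) := by
    refine hf.tendstoLocallyUniformlyOn_of_le h
      (mul_nonneg (Real.exp_pos K).le hKK) fun x hx n => ?_
    have hxI := Ico_subset_Icc_self hx
    refine (hf.abs_szekeresApprox_sub_le h hV hxI n).trans ?_
    rw [mul_assoc (Real.exp K)]
    refine mul_le_mul_of_nonneg_right ?_ (mul_nonneg hKK (hf.mapsTo.iterate n hxI).1)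
    refine (hf.szekeres_le h hV hxI).trans (mul_le_of_le_one_left (Real.exp_pos _).le ?_)
    linarith [hxI.2, (hf.mapsTo hxI).1]
  have hZ1 : TendstoLocallyUniformlyOn (szekeresApproxDeriv f) (szekeresDeriv f V) atTop
      (Ico 0 1) :=
    hf.tendstoLocallyUniformlyOn_of_le h
      (add_nonneg (add_nonneg L.coe_nonneg (mul_nonneg hKK hKK)) hKK) fun x hx n =>
        hf.abs_szekeresApproxDeriv_sub_le h hK hV hL hx n
  refine ⟨V, contDiffOn_one_Ico_of_hasDerivAt (Z := szekeresDeriv f V) ?_ ?_ ?_,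
    hf.szekeres_map_zero h hV, fun x hx => szekeres_pos h hV hx,
    fun x hx => hf.szekeres_map h hV hx⟩
  · exact hV1.continuousOn (Frequently.of_forall fun n =>
      (hf.continuousOn_szekeresApprox n).mono Ico_subset_Icc_self)
  · exact hZ1.continuousOn (Frequently.of_forall fun n =>
      (hf.continuousOn_szekeresApproxDeriv n).mono Ico_subset_Icc_self)
  · intro x hx
    exact hasDerivAt_of_tendstoLocallyUniformlyOn isOpen_Ioo (hZ1.mono Ioo_subset_Ico_self)
      (Eventually.of_forall fun n y hy => hf.hasDerivAt_szekeresApprox n hy)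
      (fun y hy => hV1.tendsto_at (Ioo_subset_Ico_self hy)) hx

end IsDiffTwoDelta

/-! ### Orbits in the open interval -/

/-- `φ` is an orbit in `(0,1)` of the nonvanishing vector field `X`, along which the translation of
time by `1` acts as `f`. -/
structure IsOrbit (f X φ : ℝ → ℝ) : Prop where
  mem : ∀ t, φ t ∈ Ioo (0 : ℝ) 1
  hasDerivAt : ∀ t, HasDerivAt φ (X (φ t)) t
  map_add_one : ∀ t, φ (t + 1) = f (φ t)
  continuousOn : ContinuousOn X (Ioo 0 1)
  ne_zero : ∀ x ∈ Ioo (0 : ℝ) 1, X x ≠ 0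

lemma exists_hasDerivAt_Ioo {u : ℝ → ℝ} (hu : ContinuousOn u (Ioo 0 1)) :
    ∃ T : ℝ → ℝ, ∀ x ∈ Ioo (0 : ℝ) 1, HasDerivAt T (u x) x := by
  refine ⟨fun x => ∫ t in (1 / 2 : ℝ)..x, u t, fun x hx => ?_⟩
  have hsub : uIcc (1 / 2 : ℝ) x ⊆ Ioo 0 1 :=
    ordConnected_Ioo.uIcc_subset (by constructor <;> norm_num) hx
  exact intervalIntegral.integral_hasDerivAt_right (hu.mono hsub).intervalIntegrable
    (hu.stronglyMeasurableAtFilter isOpen_Ioo x hx) (hu.continuousAt (Ioo_mem_nhds hx.1 hx.2))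

/-- A function on `ℝ` with derivative `1` is a translation. -/
lemma eq_add_of_hasDerivAt_one {u : ℝ → ℝ} (hu : ∀ t, HasDerivAt u 1 t) (t : ℝ) :
    u t = t + u 0 := by
  have h := is_const_of_deriv_eq_zero (f := fun t => u t - t)
    (fun t => ((hu t).sub (hasDerivAt_id t)).differentiableAt)
    (fun t => by simpa using ((hu t).fun_sub (hasDerivAt_id t)).deriv) t 0
  simp only [sub_zero] at h
  linarith

namespace IsOrbit

variable {f X φ φ' : ℝ → ℝ}

lemma continuous (h : IsOrbit f X φ) : Continuous φ :=
  continuous_iff_continuousAt.2 fun t => (h.hasDerivAt t).continuousAt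

lemma forall_pos_or_forall_neg (h : IsOrbit f X φ) :
    (∀ x ∈ Ioo (0 : ℝ) 1, 0 < X x) ∨ ∀ x ∈ Ioo (0 : ℝ) 1, X x < 0 := by
  by_contra! hc
  obtain ⟨⟨x, hx, hfx⟩, y, hy, hfy⟩ := hc
  obtain ⟨z, hz, hfz⟩ := (isPreconnected_Ioo (a := (0 : ℝ)) (b := 1)).intermediate_value₂ hx hy
    h.continuousOn continuousOn_const hfx hfy
  exact h.ne_zero z hz hfz

lemma strictMono_or_strictAnti (h : IsOrbit f X φ) : StrictMono φ ∨ StrictAnti φ := by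
  rcases h.forall_pos_or_forall_neg with hX | hX
  · exact Or.inl (strictMono_of_deriv_pos fun t => by
      rw [(h.hasDerivAt t).deriv]; exact hX _ (h.mem t))
  · exact Or.inr (strictAnti_of_deriv_neg fun t => by
      rw [(h.hasDerivAt t).deriv]; exact hX _ (h.mem t))

/-- The time function of an orbit, a left inverse of its parametrization. -/
lemma exists_time (h : IsOrbit f X φ) :
    ∃ T : ℝ → ℝ, (∀ x ∈ Ioo (0 : ℝ) 1, HasDerivAt T (X x)⁻¹ x) ∧ ∀ t, T (φ t) = t := by
  obtain ⟨T, hT⟩ := exists_hasDerivAt_Ioo (h.continuousOn.inv₀ h.ne_zero)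
  refine ⟨fun x => T x - T (φ 0), fun x hx => (hT x hx).sub_const _, fun t => ?_⟩
  have h1 : ∀ t, HasDerivAt (fun t => T (φ t)) 1 t := fun t =>
    ((hT _ (h.mem t)).comp t (h.hasDerivAt t)).congr_deriv (inv_mul_cancel₀ (h.ne_zero _ (h.mem t)))
  have h2 := eq_add_of_hasDerivAt_one h1 t
  simp only at h2 ⊢
  linarith

lemma injective (h : IsOrbit f X φ) : Function.Injective φ := by
  obtain ⟨T, -, hT⟩ := h.exists_time
  exact Function.LeftInverse.injective hT

/-- A limit of the orbit at either end of time is a fixed point, hence an endpoint. -/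
lemma limit_eq (h : IsOrbit f X φ) (hf : IsDiffTwoDelta f) {F : Filter ℝ} [F.NeBot] {l : ℝ}
    (hl : Tendsto φ F (𝓝 l)) (hl' : Tendsto (fun t => φ (t + 1)) F (𝓝 l)) : l = 0 ∨ l = 1 := by
  have hlI : l ∈ Icc (0 : ℝ) 1 :=
    isClosed_Icc.mem_of_tendsto hl (Eventually.of_forall fun t => Ioo_subset_Icc_self (h.mem t))
  have h1 : Tendsto (fun t => φ (t + 1)) F (𝓝 (f l)) := by
    simp only [h.map_add_one]
    exact (hf.continuousOn l hlI).tendsto.comp (tendsto_nhdsWithin_iff.2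
      ⟨hl, Eventually.of_forall fun t => Ioo_subset_Icc_self (h.mem t)⟩)
  have h2 := tendsto_nhds_unique h1 hl'
  by_contra! hc
  exact hf.no_fixed_point l ⟨hlI.1.lt_of_ne' hc.1, hlI.2.lt_of_ne hc.2⟩ h2

lemma bddAbove (h : IsOrbit f X φ) : BddAbove (range φ) :=
  ⟨1, by rintro _ ⟨t, rfl⟩; exact (h.mem t).2.le⟩

lemma bddBelow (h : IsOrbit f X φ) : BddBelow (range φ) :=
  ⟨0, by rintro _ ⟨t, rfl⟩; exact (h.mem t).1.le⟩

lemma tendsto_of_strictMono (h : IsOrbit f X φ) (hf : IsDiffTwoDelta f) (hφ : StrictMono φ) :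
    Tendsto φ atBot (𝓝 0) ∧ Tendsto φ atTop (𝓝 1) := by
  have h1 := tendsto_atTop_ciSup hφ.monotone h.bddAbove
  have h0 := tendsto_atBot_ciInf hφ.monotone h.bddBelow
  have h1' := h.limit_eq hf h1 (h1.comp (tendsto_atTop_add_const_right _ 1 tendsto_id))
  have h0' := h.limit_eq hf h0 (h0.comp (tendsto_atBot_add_const_right _ 1 tendsto_id))
  have h2 : (⨆ t, φ t) ≠ 0 := ((h.mem 0).1.trans_le (le_ciSup h.bddAbove 0)).ne'
  have h3 : (⨅ t, φ t) ≠ 1 := ((ciInf_le h.bddBelow 0).trans_lt (h.mem 0).2).ne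
  rw [h1'.resolve_left h2] at h1
  rw [h0'.resolve_right h3] at h0
  exact ⟨h0, h1⟩

lemma tendsto_of_strictAnti (h : IsOrbit f X φ) (hf : IsDiffTwoDelta f) (hφ : StrictAnti φ) :
    Tendsto φ atBot (𝓝 1) ∧ Tendsto φ atTop (𝓝 0) := by
  have h1 := tendsto_atBot_ciSup hφ.antitone h.bddAbove
  have h0 := tendsto_atTop_ciInf hφ.antitone h.bddBelow
  have h1' := h.limit_eq hf h1 (h1.comp (tendsto_atBot_add_const_right _ 1 tendsto_id))
  have h0' := h.limit_eq hf h0 (h0.comp (tendsto_atTop_add_const_right _ 1 tendsto_id))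
  have h2 : (⨆ t, φ t) ≠ 0 := ((h.mem 0).1.trans_le (le_ciSup h.bddAbove 0)).ne'
  have h3 : (⨅ t, φ t) ≠ 1 := ((ciInf_le h.bddBelow 0).trans_lt (h.mem 0).2).ne
  rw [h1'.resolve_left h2] at h1
  rw [h0'.resolve_right h3] at h0
  exact ⟨h1, h0⟩

lemma exists_eq (h : IsOrbit f X φ) (hf : IsDiffTwoDelta f) {x : ℝ} (hx : x ∈ Ioo (0 : ℝ) 1) :
    ∃ t, φ t = x := by
  rcases h.strictMono_or_strictAnti with hφ | hφ
  · obtain ⟨h0, h1⟩ := h.tendsto_of_strictMono hf hφ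
    exact mem_range_of_exists_le_of_exists_ge h.continuous
      ((h0.eventually (gt_mem_nhds hx.1)).exists.imp fun _ => le_of_lt)
      ((h1.eventually (lt_mem_nhds hx.2)).exists.imp fun _ => le_of_lt)
  · obtain ⟨h1, h0⟩ := h.tendsto_of_strictAnti hf hφ
    exact mem_range_of_exists_le_of_exists_ge h.continuous
      ((h0.eventually (gt_mem_nhds hx.1)).exists.imp fun _ => le_of_lt)
      ((h1.eventually (lt_mem_nhds hx.2)).exists.imp fun _ => le_of_lt)

lemma field_map (h : IsOrbit f X φ) (hf : IsDiffTwoDelta f) {x : ℝ} (hx : x ∈ Ioo (0 : ℝ) 1) :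
    X (f x) = Real.exp (logDerivUnit f x) * X x := by
  obtain ⟨t, rfl⟩ := h.exists_eq hf hx
  have h1 : HasDerivAt (fun s => φ (s + 1)) (X (φ (t + 1))) t := by
    simpa using (h.hasDerivAt (t + 1)).comp_add_const t 1
  have h2 : HasDerivAt (fun s => φ (s + 1)) (Real.exp (logDerivUnit f (φ t)) * X (φ t)) t := by
    simp only [h.map_add_one]
    exact (hf.hasDerivAt_exp (h.mem t)).comp t (h.hasDerivAt t)
  rw [← h.map_add_one]
  exact h1.unique h2

lemma map_add_nat (h : IsOrbit f X φ) (t : ℝ) (n : ℕ) : φ (t + n) = f^[n] (φ t) := by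
  induction n with
  | zero => simp
  | succ n ih => rw [Function.iterate_succ_apply', ← ih, ← h.map_add_one]; push_cast; ring_nf

/-- Two orbits of the same field differ by a translation of time. -/
lemma eq_translate (h : IsOrbit f X φ) (h' : IsOrbit f X φ') (hf : IsDiffTwoDelta f) :
    ∃ r, ∀ t, φ' t = φ (t + r) := by
  obtain ⟨T, hT, hTφ⟩ := h.exists_time
  have h1 : ∀ t, HasDerivAt (fun t => T (φ' t)) 1 t := fun t =>
    ((hT _ (h'.mem t)).comp t (h'.hasDerivAt t)).congr_deriv
      (inv_mul_cancel₀ (h.ne_zero _ (h'.mem t)))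
  refine ⟨T (φ' 0), fun t => ?_⟩
  rw [← eq_add_of_hasDerivAt_one h1 t]
  obtain ⟨s, hs⟩ := h.exists_eq hf (h'.mem t)
  rw [← hs, hTφ]

lemma congr {X' : ℝ → ℝ} (h : IsOrbit f X φ) (hX : EqOn X' X (Ioo 0 1)) : IsOrbit f X' φ where
  mem := h.mem
  hasDerivAt t := by rw [hX (h.mem t)]; exact h.hasDerivAt t
  map_add_one := h.map_add_one
  continuousOn := h.continuousOn.congr hX
  ne_zero x hx := by rw [hX hx]; exact h.ne_zero x hx

lemma reflect (h : IsOrbit f X φ) :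
    IsOrbit (fun x => 1 - f (1 - x)) (fun x => -X (1 - x)) (fun t => 1 - φ t) where
  mem t := ⟨by linarith [(h.mem t).2], by linarith [(h.mem t).1]⟩
  hasDerivAt t := by simpa using (h.hasDerivAt t).const_sub 1
  map_add_one t := by simp [h.map_add_one]
  continuousOn := (h.continuousOn.comp (by fun_prop)
    fun x hx => ⟨by linarith [hx.2], by linarith [hx.1]⟩).neg
  ne_zero x hx := neg_ne_zero.2 (h.ne_zero _ ⟨by linarith [hx.2], by linarith [hx.1]⟩)

/-- The orbit run backwards is an orbit of the inverse diffeomorphism. -/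
lemma inv {g : ℝ → ℝ} (h : IsOrbit f X φ) (hinv : InvOn g f (Icc 0 1) (Icc 0 1)) :
    IsOrbit g (fun x => -X x) (fun t => φ (1 - t)) where
  mem t := h.mem _
  hasDerivAt t := ((h.hasDerivAt (1 - t)).comp t ((hasDerivAt_id t).const_sub 1)).congr_deriv
    (by simp)
  map_add_one t := by
    have := h.map_add_one (-t)
    rw [neg_add_eq_sub] at this
    rw [this, hinv.1 (Ioo_subset_Icc_self (h.mem _))]
    ring_nf
  continuousOn := h.continuousOn.neg
  ne_zero x hx := neg_ne_zero.2 (h.ne_zero x hx)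

lemma logDeriv (h : IsOrbit f X φ) (hf : IsDiffTwoDelta f) {x : ℝ} (hx : x ∈ Ioo (0 : ℝ) 1) :
    logDerivUnit f x = Real.log (X (f x)) - Real.log (X x) := by
  rw [h.field_map hf hx, Real.log_mul (Real.exp_pos _).ne' (h.ne_zero x hx), Real.log_exp]
  ring

end IsOrbit

/-! ### Generating fields: integral curves and existence -/

/-- Uniqueness of integral curves of a `C^1` vector field on `[0,1)`. -/
lemma eq_of_hasDerivAt_of_contDiffOn {X u v : ℝ → ℝ} (hX : ContDiffOn ℝ 1 X (Ico 0 1))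
    (hu : ∀ t, u t ∈ Ico (0 : ℝ) 1 ∧ HasDerivAt u (X (u t)) t)
    (hv : ∀ t, v t ∈ Ico (0 : ℝ) 1 ∧ HasDerivAt v (X (v t)) t) {t₀ : ℝ} (h₀ : u t₀ = v t₀) :
    u = v := by
  have hbound : ∀ w : ℝ → ℝ, (∀ t, w t ∈ Ico (0 : ℝ) 1 ∧ HasDerivAt w (X (w t)) t) → ∀ a b : ℝ,
      ∃ c < (1 : ℝ), ∀ t ∈ Ioo a b, w t ≤ c := by
    intro w hw a b
    rcases (Icc a b).eq_empty_or_nonempty with he | hne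
    · exact ⟨0, zero_lt_one, fun t ht => absurd (Ioo_subset_Icc_self ht) (he ▸ notMem_empty t)⟩
    obtain ⟨s, -, hs⟩ := isCompact_Icc.exists_isMaxOn hne
      (fun t _ => (hw t).2.continuousAt.continuousWithinAt : ContinuousOn w (Icc a b))
    exact ⟨w s, (hw s).1.2, fun t ht => hs (Ioo_subset_Icc_self ht)⟩
  funext t
  set a := min t t₀ - 1
  set b := max t t₀ + 1
  obtain ⟨c, hc, huc⟩ := hbound u hu a b
  obtain ⟨d, hd, hvd⟩ := hbound v hv a b
  obtain ⟨K, hK⟩ := (hX.mono (Icc_subset_Ico_right (max_lt hc hd) :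
    Icc 0 (max c d) ⊆ Ico 0 1)).exists_lipschitzOnWith one_ne_zero (convex_Icc _ _) isCompact_Icc
  have hmin := min_le_left t t₀
  have hmin' := min_le_right t t₀
  have hmax := le_max_left t t₀
  have hmax' := le_max_right t t₀
  exact ODE_solution_unique_of_mem_Ioo (v := fun _ => X) (s := fun _ => Icc 0 (max c d))
    (a := a) (b := b) (fun _ _ => hK) ⟨by linarith, by linarith⟩
    (fun s hs => ⟨(hu s).2, (hu s).1.1, (huc s hs).trans (le_max_left _ _)⟩)
    (fun s hs => ⟨(hv s).2, (hv s).1.1, (hvd s hs).trans (le_max_right _ _)⟩) h₀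
    ⟨by linarith, by linarith⟩

namespace IsGeneratingField

variable {f g X : ℝ → ℝ} {Φ : ℝ → ℝ → ℝ} {a x : ℝ}

lemma flow_zero {S : Set ℝ} (h : IsGeneratingField f S X Φ) (hx : x ∈ S) : Φ 0 x = x :=
  (h.isFlowOn x hx).1

lemma flow_spec {S : Set ℝ} (h : IsGeneratingField f S X Φ) (hx : x ∈ S) (t : ℝ) :
    Φ t x ∈ S ∧ HasDerivAt (fun s => Φ s x) (X (Φ t x)) t :=
  (h.isFlowOn x hx).2 t

/-- The field vanishes at the endpoint, as its integral curve there cannot leave `[0,1)`. -/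
lemma field_zero (h : IsGeneratingField f (Ico 0 1) X Φ) : X 0 = 0 := by
  have h0 : (0 : ℝ) ∈ Ico (0 : ℝ) 1 := ⟨le_rfl, zero_lt_one⟩
  have hmin : IsLocalMin (fun s => Φ s 0) 0 := Eventually.of_forall fun t => by
    simpa only [h.flow_zero h0] using (h.flow_spec h0 t).1.1
  have := hmin.hasDerivAt_eq_zero (h.flow_spec h0 0).2
  rwa [h.flow_zero h0] at this

lemma flow_add (h : IsGeneratingField f (Ico 0 1) X Φ) (hx : x ∈ Ico (0 : ℝ) 1) (s t : ℝ) :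
    Φ (s + t) x = Φ s (Φ t x) := by
  have := eq_of_hasDerivAt_of_contDiffOn (t₀ := 0) h.contDiffOn
    (u := fun s => Φ (s + t) x) (v := fun s => Φ s (Φ t x))
    (fun s => ⟨(h.flow_spec hx (s + t)).1, (h.flow_spec hx (s + t)).2.comp_add_const s t⟩)
    (h.flow_spec (h.flow_spec hx t).1) (by simp [h.flow_zero (h.flow_spec hx t).1])
  exact congrFun this s

/-- The field vanishes nowhere on `(0,1)` and its orbits there stay away from `0`, since otherwise
uniqueness of integral curves would make an orbit constant. -/
lemma isOrbit (h : IsGeneratingField f (Ico 0 1) X Φ) (hf : IsDiffTwoDelta f)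
    (ha : a ∈ Ioo (0 : ℝ) 1) : IsOrbit f X fun t => Φ t a := by
  have haI := Ioo_subset_Ico_self ha
  refine ⟨fun t => ⟨(h.flow_spec haI t).1.1.lt_of_ne' fun h0 => ha.1.ne' ?_,
    (h.flow_spec haI t).1.2⟩, fun t => (h.flow_spec haI t).2, fun t => ?_,
    h.contDiffOn.continuousOn.mono Ioo_subset_Ico_self, fun x hx h0 => ?_⟩
  · have := eq_of_hasDerivAt_of_contDiffOn (t₀ := t) h.contDiffOn (h.flow_spec haI)
      (v := fun _ => 0) (fun t => ⟨⟨le_rfl, zero_lt_one⟩, by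
        rw [h.field_zero]; exact hasDerivAt_const t 0⟩) h0
    rw [← h.flow_zero haI]
    exact congrFun this 0
  · rw [add_comm, h.flow_add haI, h.time_one _ (h.flow_spec haI t).1]
  · have hxI := Ioo_subset_Ico_self hx
    have := eq_of_hasDerivAt_of_contDiffOn (t₀ := 0) h.contDiffOn (h.flow_spec hxI)
      (v := fun _ => x) (fun t => ⟨hxI, by rw [h0]; exact hasDerivAt_const t x⟩)
      (h.flow_zero hxI)
    apply hf.no_fixed_point x hx
    rw [← h.time_one x hxI]
    exact congrFun this 1

lemma inv (h : IsGeneratingField f (Ico 0 1) X Φ)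
    (hinv : InvOn g f (Icc 0 1) (Icc 0 1)) :
    IsGeneratingField g (Ico 0 1) (fun x => -X x) fun t x => Φ (-t) x where
  contDiffOn := h.contDiffOn.neg
  isFlowOn x hx := ⟨by simpa using h.flow_zero hx, fun t => ⟨(h.flow_spec hx _).1,
    ((h.flow_spec hx (-t)).2.comp t (hasDerivAt_neg t)).congr_deriv (by simp)⟩⟩
  time_one x hx := by
    have h1 := (h.flow_spec hx (-1)).1
    have h2 := h.flow_add hx 1 (-1)
    rw [add_neg_cancel, h.flow_zero hx, h.time_one _ h1] at h2
    nth_rw 2 [h2]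
    exact (hinv.1 (Ico_subset_Icc_self h1)).symm

lemma reflect_Ioc (h : IsGeneratingField f (Ioc 0 1) X Φ) :
    IsGeneratingField (fun x => 1 - f (1 - x)) (Ico 0 1) (fun x => -X (1 - x))
      fun t x => 1 - Φ t (1 - x) where
  contDiffOn := (h.contDiffOn.comp (by fun_prop)
    fun x (hx : x ∈ Ico (0 : ℝ) 1) => ⟨by linarith [hx.2], by linarith [hx.1]⟩).neg
  isFlowOn x hx := by
    have hx' : 1 - x ∈ Ioc (0 : ℝ) 1 := ⟨by linarith [hx.2], by linarith [hx.1]⟩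
    refine ⟨by simp [h.flow_zero hx'], fun t => ⟨?_, ?_⟩⟩
    · have := (h.flow_spec hx' t).1
      exact ⟨by linarith [this.2], by linarith [this.1]⟩
    · simpa using (h.flow_spec hx' t).2.const_sub 1
  time_one x hx := by rw [h.time_one]; exact ⟨by linarith [hx.2], by linarith [hx.1]⟩

lemma reflect_Ico (h : IsGeneratingField f (Ico 0 1) X Φ) :
    IsGeneratingField (fun x => 1 - f (1 - x)) (Ioc 0 1) (fun x => -X (1 - x))
      fun t x => 1 - Φ t (1 - x) where
  contDiffOn := (h.contDiffOn.comp (by fun_prop)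
    fun x (hx : x ∈ Ioc (0 : ℝ) 1) => ⟨by linarith [hx.2], by linarith [hx.1]⟩).neg
  isFlowOn x hx := by
    have hx' : 1 - x ∈ Ico (0 : ℝ) 1 := ⟨by linarith [hx.2], by linarith [hx.1]⟩
    refine ⟨by simp [h.flow_zero hx'], fun t => ⟨?_, ?_⟩⟩
    · have := (h.flow_spec hx' t).1
      exact ⟨by linarith [this.2], by linarith [this.1]⟩
    · simpa using (h.flow_spec hx' t).2.const_sub 1
  time_one x hx := by rw [h.time_one]; exact ⟨by linarith [hx.2], by linarith [hx.1]⟩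

lemma isOrbit_Ioc (h : IsGeneratingField f (Ioc 0 1) X Φ) (hf : IsDiffTwoDelta f)
    (ha : a ∈ Ioo (0 : ℝ) 1) : IsOrbit f X fun t => Φ t a := by
  have := (h.reflect_Ioc.isOrbit hf.reflect
    (a := 1 - a) ⟨by linarith [ha.2], by linarith [ha.1]⟩).reflect
  simpa using this

end IsGeneratingField

namespace IsDiffTwoDelta

variable {f : ℝ → ℝ}

/-- Existence of the Szekeres vector field of a contraction: the invariant field is integrated, and
rescaled so as to generate `f` in time one. -/
lemma exists_isGeneratingField_of_lt (hf : IsDiffTwoDelta f) (h : ∀ x ∈ Ioo (0 : ℝ) 1, f x < x) :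
    ∃ X Φ, IsGeneratingField f (Ico 0 1) X Φ := by
  obtain ⟨V, hVC, hV0, hVpos, hVf⟩ := hf.exists_invariant_field h
  obtain ⟨U, hU⟩ := exists_hasDerivAt_Ioo
    ((hVC.continuousOn.mono Ioo_subset_Ico_self).inv₀ fun x hx => (hVpos x hx).ne')
  have hUmono : StrictMonoOn U (Ioo 0 1) := strictMonoOn_of_deriv_pos (convex_Ioo 0 1)
    (fun x hx => (hU x hx).continuousAt.continuousWithinAt) fun x hx => by
      rw [interior_Ioo] at hx
      rw [(hU x hx).deriv]
      exact inv_pos.2 (hVpos x hx)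
  have hhalf : (1 / 2 : ℝ) ∈ Ioo (0 : ℝ) 1 := by constructor <;> norm_num
  -- by invariance of the field, `U - U ∘ f` has derivative zero
  obtain ⟨τ, hτ0, hτ⟩ : ∃ τ > 0, ∀ x ∈ Ioo (0 : ℝ) 1, U (f x) = U x - τ := by
    have hd : ∀ x ∈ Ioo (0 : ℝ) 1, HasDerivAt (fun x => U x - U (f x)) 0 x := by
      intro x hx
      refine ((hU x hx).sub ((hU _ (hf.mapsTo_Ioo hx)).comp x (hf.hasDerivAt_exp hx))).congr_deriv
        ?_
      have := (hVpos x hx).ne'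
      have := (Real.exp_pos (logDerivUnit f x)).ne'
      rw [Pi.inv_apply, Pi.inv_apply, hVf x (Ioo_subset_Ico_self hx)]
      field_simp
      ring
    refine ⟨U (1 / 2) - U (f (1 / 2)),
      sub_pos.2 (hUmono (hf.mapsTo_Ioo hhalf) hhalf (h _ hhalf)), fun x hx => ?_⟩
    have := isOpen_Ioo.is_const_of_deriv_eq_zero (isPreconnected_Ioo (a := (0 : ℝ)) (b := 1))
      (fun y hy => (hd y hy).differentiableAt.differentiableWithinAt)
      (fun y hy => (hd y hy).deriv) hx hhalf
    linarith
  -- `W` is the time function of the rescaled field, on which `f` acts as a unit translation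
  set W : ℝ → ℝ := fun x => U x / τ with hWdef
  have hWf : ∀ x ∈ Ioo (0 : ℝ) 1, W (f x) = W x - 1 := fun x hx => by
    simp only [hWdef, hτ x hx]
    field_simp
  have hWd : ∀ x ∈ Ioo (0 : ℝ) 1, HasDerivAt W ((V x)⁻¹ / τ) x := fun x hx => (hU x hx).div_const τ
  have hWmono : StrictMonoOn W (Ioo 0 1) := fun x hx y hy hxy =>
    div_lt_div_of_pos_right (hUmono hx hy hxy) hτ0
  obtain ⟨g, hg, hinv⟩ := hf.exists_inv
  have hWg : ∀ x ∈ Ioo (0 : ℝ) 1, W (g x) = W x + 1 := fun x hx => by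
    have := hWf (g x) (hg.mapsTo_Ioo hx)
    rw [hinv.2 (Ioo_subset_Icc_self hx)] at this
    linarith
  have hWfn : ∀ n : ℕ, W (f^[n] (1 / 2)) = W (1 / 2) - n := fun n => by
    induction n with
    | zero => simp
    | succ n ih =>
      rw [Function.iterate_succ_apply', hWf _ (hf.mapsTo_Ioo.iterate n hhalf), ih]
      push_cast; ring
  have hWgn : ∀ n : ℕ, W (g^[n] (1 / 2)) = W (1 / 2) + n := fun n => by
    induction n with
    | zero => simp
    | succ n ih =>
      rw [Function.iterate_succ_apply', hWg _ (hg.mapsTo_Ioo.iterate n hhalf), ih]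
      push_cast; ring
  have hsurj : Function.Surjective fun x : Ioo (0 : ℝ) 1 => W x := by
    intro s
    obtain ⟨n, hn⟩ := exists_nat_ge |s - W (1 / 2)|
    have hn' := abs_le.1 hn
    have hW' : ContinuousOn W (Ioo 0 1) := fun x hx => (hWd x hx).continuousAt.continuousWithinAt
    obtain ⟨x, hx, hxs⟩ := (isPreconnected_Ioo.image W hW').ordConnected.out
      (mem_image_of_mem W (hf.mapsTo_Ioo.iterate n hhalf))
      (mem_image_of_mem W (hg.mapsTo_Ioo.iterate n hhalf))
      (show s ∈ Icc _ _ by rw [hWfn, hWgn]; exact ⟨by linarith [hn'.1], by linarith [hn'.2]⟩)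
    exact ⟨⟨x, hx⟩, hxs⟩
  let e : Ioo (0 : ℝ) 1 ≃o ℝ := StrictMono.orderIsoOfSurjective (fun x : Ioo (0 : ℝ) 1 => W x)
    (fun x y hxy => hWmono x.2 y.2 hxy) hsurj
  have hWe : ∀ s, W (e.symm s) = s := fun s => e.apply_symm_apply s
  have heW : ∀ x (hx : x ∈ Ioo (0 : ℝ) 1), (e.symm (W x) : ℝ) = x := fun x hx =>
    congrArg Subtype.val (e.symm_apply_apply ⟨x, hx⟩)
  have hed : ∀ s, HasDerivAt (fun s => (e.symm s : ℝ)) (τ * V (e.symm s)) s := by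
    intro s
    have hVs := (hVpos _ (e.symm s).2).ne'
    refine (HasDerivAt.of_local_left_inverse (f := W)
      (continuous_subtype_val.comp e.symm.continuous).continuousAt (hWd _ (e.symm s).2)
      (div_ne_zero (inv_ne_zero hVs) hτ0.ne') (Eventually.of_forall hWe)).congr_deriv ?_
    field_simp
    rfl
  classical
  refine ⟨fun x => -(τ * V x),
    fun t x => if x ∈ Ioo (0 : ℝ) 1 then (e.symm (W x - t) : ℝ) else x,
    (contDiffOn_const.mul hVC).neg, ?_, ?_⟩
  · intro x hx
    by_cases hx' : x ∈ Ioo (0 : ℝ) 1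
    · simp only [hx', if_true, sub_zero]
      refine ⟨heW x hx', fun t => ⟨Ioo_subset_Ico_self (e.symm _).2, ?_⟩⟩
      exact ((hed (W x - t)).comp t ((hasDerivAt_id t).const_sub (W x))).congr_deriv (by simp)
    · obtain rfl : x = 0 := by
        by_contra h0
        exact hx' ⟨hx.1.lt_of_ne' h0, hx.2⟩
      simp only [hx', if_false, hV0, mul_zero, neg_zero]
      exact ⟨trivial, fun t => ⟨hx, hasDerivAt_const t 0⟩⟩
  · intro x hx
    by_cases hx' : x ∈ Ioo (0 : ℝ) 1
    · simp only [hx', if_true]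
      rw [← hWf x hx', heW _ (hf.mapsTo_Ioo hx')]
    · obtain rfl : x = 0 := by
        by_contra h0
        exact hx' ⟨hx.1.lt_of_ne' h0, hx.2⟩
      simp only [hx', if_false, hf.map_zero]

lemma exists_isGeneratingField_Ico (hf : IsDiffTwoDelta f) :
    ∃ X Φ, IsGeneratingField f (Ico 0 1) X Φ := by
  rcases hf.forall_lt_or_forall_gt with h | h
  · exact hf.exists_isGeneratingField_of_lt h
  · obtain ⟨g, hg, hinv⟩ := hf.exists_inv
    obtain ⟨X, Φ, hX⟩ := hg.exists_isGeneratingField_of_lt (inv_lt hg hinv h)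
    exact ⟨_, _, hX.inv hinv.symm⟩

lemma exists_isGeneratingField_Ioc (hf : IsDiffTwoDelta f) :
    ∃ X Φ, IsGeneratingField f (Ioc 0 1) X Φ := by
  obtain ⟨X, Φ, hX⟩ := hf.reflect.exists_isGeneratingField_Ico
  have := hX.reflect_Ico
  simp only [sub_sub_cancel] at this
  exact ⟨_, _, this⟩

end IsDiffTwoDelta

/-! ### Behaviour at the endpoint and uniqueness of the generating fields -/

namespace IsOrbit

variable {f X φ : ℝ → ℝ}

lemma strictAnti_of_lt (h : IsOrbit f X φ) (hlt : ∀ x ∈ Ioo (0 : ℝ) 1, f x < x) :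
    StrictAnti φ := by
  refine h.strictMono_or_strictAnti.resolve_left fun hφ => ?_
  have h1 := hφ (lt_add_one (0 : ℝ))
  rw [h.map_add_one] at h1
  exact lt_asymm h1 (hlt _ (h.mem 0))

/-- Along an orbit, the logarithm of the field has the derivative of the field as derivative. -/
lemma hasDerivAt_log (h : IsOrbit f X φ) (hX : ContDiffOn ℝ 1 X (Ico 0 1)) (t : ℝ) :
    HasDerivAt (fun t => Real.log (X (φ t))) (derivWithin X (Ico 0 1) (φ t)) t := by
  have h1 : HasDerivAt X (derivWithin X (Ico 0 1) (φ t)) (φ t) :=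
    ((hX.differentiableOn one_ne_zero) _
      (Ioo_subset_Ico_self (h.mem t))).hasDerivWithinAt.hasDerivAt
        (Ico_mem_nhds (h.mem t).1 (h.mem t).2)
  refine ((h1.comp t (h.hasDerivAt t)).log (h.ne_zero _ (h.mem t))).congr_deriv ?_
  exact mul_div_cancel_right₀ _ (h.ne_zero _ (h.mem t))

lemma tendsto_derivWithin_comp (h : IsOrbit f X φ) (hf : IsDiffTwoDelta f)
    (hlt : ∀ x ∈ Ioo (0 : ℝ) 1, f x < x) (hX : ContDiffOn ℝ 1 X (Ico 0 1)) :
    Tendsto (fun t => derivWithin X (Ico 0 1) (φ t)) atTop (𝓝 (derivWithin X (Ico 0 1) 0)) := by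
  have h0 := (h.tendsto_of_strictAnti hf (h.strictAnti_of_lt hlt)).2
  exact (hX.continuousOn_derivWithin (uniqueDiffOn_Ico 0 1) le_rfl 0
    ⟨le_rfl, zero_lt_one⟩).tendsto.comp (tendsto_nhdsWithin_iff.2
      ⟨h0, Eventually.of_forall fun t => Ioo_subset_Ico_self (h.mem t)⟩)

/-- The derivative of a generating field at the endpoint is the logarithm of the multiplier of
`f`: by the mean value theorem, `log Df` takes values of the derivative of the field along each
orbit. -/
lemma derivWithin_field_zero (h : IsOrbit f X φ) (hf : IsDiffTwoDelta f)
    (hlt : ∀ x ∈ Ioo (0 : ℝ) 1, f x < x) (hX : ContDiffOn ℝ 1 X (Ico 0 1)) :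
    derivWithin X (Ico 0 1) 0 = logDerivUnit f 0 := by
  have h0 := (h.tendsto_of_strictAnti hf (h.strictAnti_of_lt hlt)).2
  have hex : ∀ t, ∃ ξ ∈ Ioo t (t + 1),
      derivWithin X (Ico 0 1) (φ ξ) = logDerivUnit f (φ t) := by
    intro t
    obtain ⟨ξ, hξ, heq⟩ := exists_hasDerivAt_eq_slope _ _ (lt_add_one t)
      (fun s _ => (h.hasDerivAt_log hX s).continuousAt.continuousWithinAt)
      (fun s _ => h.hasDerivAt_log hX s)
    refine ⟨ξ, hξ, ?_⟩
    rw [heq, h.map_add_one, h.logDeriv hf (h.mem t)]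
    simp
  choose ξ hξ heq using hex
  have h1 : Tendsto ξ atTop atTop := tendsto_atTop_mono (fun t => (hξ t).1.le) tendsto_id
  have h2 := (h.tendsto_derivWithin_comp hf hlt hX).comp h1
  have h3 : Tendsto (fun t => logDerivUnit f (φ t)) atTop (𝓝 (logDerivUnit f 0)) :=
    (hf.continuousOn_logDerivUnit 0 (left_mem_Icc.2 zero_le_one)).tendsto.comp
      (tendsto_nhdsWithin_iff.2
        ⟨h0, Eventually.of_forall fun t => Ioo_subset_Icc_self (h.mem t)⟩)
  refine tendsto_nhds_unique (h2.congr fun t => ?_) h3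
  exact heq t

/-- Over the unit intervals of time, the logarithm of the field is Lipschitz along the orbit, with
constants converging to the logarithm of the multiplier of `f` at the endpoint. -/
lemma exists_abs_log_sub_le (h : IsOrbit f X φ) (hf : IsDiffTwoDelta f)
    (hlt : ∀ x ∈ Ioo (0 : ℝ) 1, f x < x) (hX : ContDiffOn ℝ 1 X (Ico 0 1)) :
    ∃ e : ℕ → ℝ, Tendsto e atTop (𝓝 |logDerivUnit f 0|) ∧ ∀ j, 0 ≤ e j ∧
      ∀ s ∈ Icc (j : ℝ) (j + 1), ∀ t ∈ Icc (j : ℝ) (j + 1),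
        |Real.log (X (φ s)) - Real.log (X (φ t))| ≤ e j * |s - t| := by
  have hc : Continuous fun t => derivWithin X (Ico 0 1) (φ t) := by
    rw [← continuousOn_univ]
    exact ((hX.continuousOn_derivWithin (uniqueDiffOn_Ico 0 1) le_rfl).comp
      h.continuous.continuousOn fun t _ => Ioo_subset_Ico_self (h.mem t))
  have hex : ∀ j : ℕ, ∃ ξ ∈ Icc (j : ℝ) (j + 1), IsMaxOn (fun t =>
      |derivWithin X (Ico 0 1) (φ t)|) (Icc (j : ℝ) (j + 1)) ξ := fun j =>
    isCompact_Icc.exists_isMaxOn (nonempty_Icc.2 (by linarith)) hc.abs.continuousOn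
  choose ξ hξ hmax using hex
  refine ⟨fun j => |derivWithin X (Ico 0 1) (φ (ξ j))|, ?_, fun j => ⟨abs_nonneg _, ?_⟩⟩
  · rw [← h.derivWithin_field_zero hf hlt hX]
    exact ((h.tendsto_derivWithin_comp hf hlt hX).comp
      (tendsto_atTop_mono (fun j => (hξ j).1) tendsto_natCast_atTop_atTop)).abs
  · intro s hs t ht
    exact (convex_Icc (j : ℝ) (j + 1)).norm_image_sub_le_of_norm_hasDerivWithin_le
      (fun u _ => (h.hasDerivAt_log hX u).hasDerivWithinAt) (fun u hu => hmax j hu) ht hs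

/-- Near the fixed point of a contraction, a generating field is equivalent to a function that
depends on `f` only. -/
lemma tendsto_field_div (h : IsOrbit f X φ) (hf : IsDiffTwoDelta f)
    (hlt : ∀ x ∈ Ioo (0 : ℝ) 1, f x < x) (hX : ContDiffOn ℝ 1 X (Ico 0 1)) (hX0 : X 0 = 0) :
    Tendsto (fun n : ℕ => X (f^[n] (φ 0)) / if logDerivUnit f 0 = 0 then
      f^[n + 1] (φ 0) - f^[n] (φ 0) else logDerivUnit f 0 * f^[n] (φ 0)) atTop (𝓝 1) := by
  have hn : ∀ n : ℕ, f^[n] (φ 0) = φ n := fun n => by rw [← h.map_add_nat, zero_add]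
  simp only [hn]
  have h0 : Tendsto (fun n : ℕ => φ n) atTop (𝓝 0) :=
    (h.tendsto_of_strictAnti hf (h.strictAnti_of_lt hlt)).2.comp tendsto_natCast_atTop_atTop
  by_cases hl : logDerivUnit f 0 = 0
  · simp only [hl, if_true]
    obtain ⟨e, he, hlip⟩ := h.exists_abs_log_sub_le hf hlt hX
    rw [hl, abs_zero] at he
    -- the increment of the orbit is the field at an intermediate time
    have hex : ∀ n : ℕ, ∃ ξ ∈ Ioo (n : ℝ) (n + 1), X (φ ξ) = φ (n + 1 : ℕ) - φ n := by
      intro n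
      obtain ⟨ξ, hξ, heq⟩ := exists_hasDerivAt_eq_slope φ (fun t => X (φ t)) (lt_add_one (n : ℝ))
        h.continuous.continuousOn (fun s _ => h.hasDerivAt s)
      exact ⟨ξ, hξ, by rw [heq]; simp⟩
    choose ξ hξ heq using hex
    have hratio : ∀ n : ℕ, X (φ n) / (φ (n + 1 : ℕ) - φ n) =
        Real.exp (Real.log (X (φ n)) - Real.log (X (φ (ξ n)))) := by
      intro n
      rw [← heq, ← Real.log_div (h.ne_zero _ (h.mem _)) (h.ne_zero _ (h.mem _)), Real.exp_log]
      rcases h.forall_pos_or_forall_neg with hs | hs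
      · exact div_pos (hs _ (h.mem _)) (hs _ (h.mem _))
      · exact div_pos_of_neg_of_neg (hs _ (h.mem _)) (hs _ (h.mem _))
    simp only [hratio]
    have hlim : Tendsto (fun n : ℕ => Real.log (X (φ n)) - Real.log (X (φ (ξ n)))) atTop
        (𝓝 0) := by
      refine squeeze_zero_norm (fun n => ?_) he
      refine ((hlip n).2 n ⟨le_rfl, by linarith⟩ (ξ n) ⟨(hξ n).1.le, (hξ n).2.le⟩).trans ?_
      refine mul_le_of_le_one_right (hlip n).1 ?_
      rw [abs_le]
      constructor <;> linarith [(hξ n).1, (hξ n).2]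
    rw [← Real.exp_zero]
    exact (Real.continuous_exp.tendsto 0).comp hlim
  · simp only [hl, if_false]
    have h1 : HasDerivWithinAt X (logDerivUnit f 0) (Ico 0 1) 0 := by
      rw [← h.derivWithin_field_zero hf hlt hX]
      exact ((hX.differentiableOn one_ne_zero) 0 ⟨le_rfl, zero_lt_one⟩).hasDerivWithinAt
    have h2 := (hasDerivWithinAt_iff_tendsto_slope.1 h1).comp (tendsto_nhdsWithin_iff.2
      ⟨h0, Eventually.of_forall fun n => (⟨Ioo_subset_Ico_self (h.mem n), (h.mem n).1.ne'⟩ :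
        φ n ∈ Ico (0 : ℝ) 1 \ {0})⟩)
    have h3 := h2.div_const (logDerivUnit f 0)
    rw [div_self hl] at h3
    refine h3.congr fun n => ?_
    simp only [Function.comp_apply, slope_def_field, hX0, sub_zero]
    rw [div_div, mul_comm]

end IsOrbit

namespace IsGeneratingField

variable {f X X' : ℝ → ℝ} {Φ Φ' : ℝ → ℝ → ℝ}

/-- Uniqueness of the Szekeres vector field of a contraction: the quotient of two generating fields
is invariant under `f` and tends to `1` along the orbits. -/
lemma eqOn_of_lt (h : IsGeneratingField f (Ico 0 1) X Φ) (h' : IsGeneratingField f (Ico 0 1) X' Φ')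
    (hf : IsDiffTwoDelta f) (hlt : ∀ x ∈ Ioo (0 : ℝ) 1, f x < x) : EqOn X X' (Ioo 0 1) := by
  intro x hx
  have ho := h.isOrbit hf hx
  have ho' := h'.isOrbit hf hx
  have h1 := ho.tendsto_field_div hf hlt h.contDiffOn h.field_zero
  have h1' := ho'.tendsto_field_div hf hlt h'.contDiffOn h'.field_zero
  rw [h.flow_zero (Ioo_subset_Ico_self hx)] at h1
  rw [h'.flow_zero (Ioo_subset_Ico_self hx)] at h1'
  have hx' : ∀ n, f^[n] x ∈ Ioo (0 : ℝ) 1 := fun n => hf.mapsTo_Ioo.iterate n hx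
  have hq : ∀ n : ℕ, X (f^[n] x) / X' (f^[n] x) = X x / X' x := by
    intro n
    induction n with
    | zero => rfl
    | succ n ih =>
      rw [Function.iterate_succ_apply', ho.field_map hf (hx' n), ho'.field_map hf (hx' n),
        mul_div_mul_left _ _ (Real.exp_pos _).ne', ih]
  have h2 := h1.div h1' one_ne_zero
  rw [div_one] at h2
  have h3 : Tendsto (fun _ : ℕ => X x / X' x) atTop (𝓝 1) := by
    refine h2.congr' ?_
    filter_upwards [h1.eventually_ne one_ne_zero] with n hn
    rw [Pi.div_apply, div_div_div_cancel_right₀ (fun h0 => hn (by rw [h0, div_zero])), hq]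
  have h4 := tendsto_nhds_unique tendsto_const_nhds h3
  exact (div_eq_one_iff_eq (ho'.ne_zero x hx)).1 h4

lemma eqOn_Ico (h : IsGeneratingField f (Ico 0 1) X Φ) (h' : IsGeneratingField f (Ico 0 1) X' Φ')
    (hf : IsDiffTwoDelta f) : EqOn X X' (Ioo 0 1) := by
  rcases hf.forall_lt_or_forall_gt with hlt | hgt
  · exact h.eqOn_of_lt h' hf hlt
  · obtain ⟨g, hg, hinv⟩ := hf.exists_inv
    exact fun x hx => neg_injective ((h.inv hinv).eqOn_of_lt (h'.inv hinv) hg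
      (IsDiffTwoDelta.inv_lt hg hinv hgt) hx)

lemma eqOn_Ioc (h : IsGeneratingField f (Ioc 0 1) X Φ) (h' : IsGeneratingField f (Ioc 0 1) X' Φ')
    (hf : IsDiffTwoDelta f) : EqOn X X' (Ioo 0 1) := by
  intro x hx
  have := h.reflect_Ioc.eqOn_Ico h'.reflect_Ioc hf.reflect
    (x := 1 - x) ⟨by linarith [hx.2], by linarith [hx.1]⟩
  simpa using this

end IsGeneratingField

/-! ### The Mather invariant as a rotation class -/

namespace IsOrbit

variable {f X Y φ ψ M : ℝ → ℝ}

lemma field_neg_of_lt (h : IsOrbit f X φ) (hlt : ∀ x ∈ Ioo (0 : ℝ) 1, f x < x) :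
    ∀ x ∈ Ioo (0 : ℝ) 1, X x < 0 := by
  refine h.forall_pos_or_forall_neg.resolve_left fun hX => ?_
  have hφ : StrictMono φ := strictMono_of_deriv_pos fun t => by
    rw [(h.hasDerivAt t).deriv]; exact hX _ (h.mem t)
  exact absurd (hφ zero_lt_one) (h.strictAnti_of_lt hlt zero_lt_one).not_gt

lemma field_pos_of_gt (h : IsOrbit f X φ) (hf : IsDiffTwoDelta f)
    (hgt : ∀ x ∈ Ioo (0 : ℝ) 1, x < f x) : ∀ x ∈ Ioo (0 : ℝ) 1, 0 < X x := by
  obtain ⟨g, hg, hinv⟩ := hf.exists_inv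
  intro x hx
  have := (h.inv hinv).field_neg_of_lt (IsDiffTwoDelta.inv_lt hg hinv hgt) x hx
  linarith

lemma div_field_pos (hX : IsOrbit f X φ) (hY : IsOrbit f Y ψ) (hf : IsDiffTwoDelta f) :
    ∀ x ∈ Ioo (0 : ℝ) 1, 0 < X x / Y x := by
  intro x hx
  rcases hf.forall_lt_or_forall_gt with h | h
  · exact div_pos_of_neg_of_neg (hX.field_neg_of_lt h x hx) (hY.field_neg_of_lt h x hx)
  · exact div_pos (hX.field_pos_of_gt hf h x hx) (hY.field_pos_of_gt hf h x hx)

/-- The change of time between two orbits is differentiable, its derivative being the quotient of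
the fields. -/
lemma hasDerivAt_transition (hX : IsOrbit f X φ) (hY : IsOrbit f Y ψ) (hM : ∀ t, ψ (M t) = φ t)
    (t : ℝ) : HasDerivAt M (X (φ t) / Y (φ t)) t := by
  obtain ⟨T, hT, hTψ⟩ := hY.exists_time
  have hMT : M = fun t => T (φ t) := funext fun t => by rw [← hM, hTψ]
  rw [hMT]
  exact ((hT _ (hX.mem t)).comp t (hX.hasDerivAt t)).congr_deriv (by rw [div_eq_inv_mul])

lemma exists_transition (hX : IsOrbit f X φ) (hY : IsOrbit f Y ψ) (hf : IsDiffTwoDelta f) :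
    ∃ M : ℝ → ℝ, ∀ t, ψ (M t) = φ t :=
  ⟨_, fun t => (hY.exists_eq hf (hX.mem t)).choose_spec⟩

lemma isCircleDiffTwoLift (hX : IsOrbit f X φ) (hY : IsOrbit f Y ψ) (hf : IsDiffTwoDelta f)
    (hXC : ContDiffOn ℝ 1 X (Ioo 0 1)) (hYC : ContDiffOn ℝ 1 Y (Ioo 0 1))
    (hM : ∀ t, ψ (M t) = φ t) : IsCircleDiffTwoLift M := by
  have hd := hX.hasDerivAt_transition hY hM
  have hderiv : deriv M = fun t => X (φ t) / Y (φ t) := funext fun t => (hd t).deriv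
  have hφ : ContDiff ℝ 1 φ := by
    rw [contDiff_one_iff_deriv]
    refine ⟨fun t => (hX.hasDerivAt t).differentiableAt, ?_⟩
    rw [funext fun t => (hX.hasDerivAt t).deriv, ← continuousOn_univ]
    exact hX.continuousOn.comp hX.continuous.continuousOn fun t _ => hX.mem t
  refine ⟨?_, fun t => ?_, fun t => hY.injective ?_⟩
  · rw [show (2 : WithTop ℕ∞) = 1 + 1 by norm_num, contDiff_succ_iff_deriv]
    refine ⟨fun t => (hd t).differentiableAt, by simp, ?_⟩
    rw [hderiv, ← contDiffOn_univ]
    exact (hXC.div hYC hY.ne_zero).comp hφ.contDiffOn fun t _ => hX.mem t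
  · rw [hderiv]
    exact hX.div_field_pos hY hf _ (hX.mem t)
  · rw [hM, hX.map_add_one, hY.map_add_one, hM]

end IsOrbit

/-- The Mather invariant is a full class of lifts modulo rotations: by uniqueness of the generating
fields, changing the representative amounts to translating time along the two orbits. -/
theorem isRotationClass_matherInvariant {f : ℝ → ℝ} (hf : IsDiffTwoDelta f) :
    IsRotationClass (matherInvariant f) := by
  obtain ⟨X, Φ, hX⟩ := hf.exists_isGeneratingField_Ico
  obtain ⟨Y, Ψ, hY⟩ := hf.exists_isGeneratingField_Ioc
  have hhalf : (1 / 2 : ℝ) ∈ Ioo (0 : ℝ) 1 := by constructor <;> norm_num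
  have hXo := hX.isOrbit hf hhalf
  have hYo := hY.isOrbit_Ioc hf hhalf
  obtain ⟨M₀, hM₀⟩ := hXo.exists_transition hYo hf
  refine ⟨M₀, hXo.isCircleDiffTwoLift hYo hf (hX.contDiffOn.mono Ioo_subset_Ico_self)
    (hY.contDiffOn.mono Ioo_subset_Ioc_self) hM₀, Subset.antisymm ?_ ?_⟩
  · rintro M ⟨X', Y', Φ', Ψ', a, b, hX', hY', ha, hb, hM⟩
    obtain ⟨r, hr⟩ := hXo.eq_translate ((hX'.isOrbit hf ha).congr (hX.eqOn_Ico hX' hf)) hf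
    obtain ⟨s, hs⟩ := hYo.eq_translate ((hY'.isOrbit_Ioc hf hb).congr (hY.eqOn_Ioc hY' hf)) hf
    refine ⟨r, -s, funext fun t => ?_⟩
    have h1 : Ψ (M t + s) (1 / 2) = Ψ (M₀ (t + r)) (1 / 2) := by
      rw [← hs, hM, hr, hM₀]
    have h2 := hYo.injective h1
    linarith
  · rintro _ ⟨r, s, rfl⟩
    have ha := hXo.mem r
    have hb := hYo.mem (-s)
    refine ⟨X, Y, Φ, Ψ, Φ r (1 / 2), Ψ (-s) (1 / 2), hX, hY, ha, hb, fun t => ?_⟩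
    obtain ⟨r', hr'⟩ := hXo.eq_translate (hX.isOrbit hf ha) hf
    obtain ⟨s', hs'⟩ := hYo.eq_translate (hY.isOrbit_Ioc hf hb) hf
    have h1 : r = r' := hXo.injective <|
      (hX.flow_zero (Ioo_subset_Ico_self ha)).symm.trans ((hr' 0).trans (by rw [zero_add]))
    have h2 : -s = s' := hYo.injective <|
      (hY.flow_zero (Ioo_subset_Ioc_self hb)).symm.trans ((hs' 0).trans (by rw [zero_add]))
    rw [hr', hs', ← h1, ← h2, ← hM₀]
    ring_nf

/-! ### Total variation and the distortion of iterates -/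

namespace eVariationOn

variable {u : ℝ → ℝ}

lemma add_le (u v : ℝ → ℝ) (s : Set ℝ) :
    eVariationOn (fun x => u x + v x) s ≤ eVariationOn u s + eVariationOn v s := by
  refine iSup_le fun ⟨n, w, hw, hs⟩ => ?_
  calc _ ≤ ∑ i ∈ Finset.range n, (edist (u (w (i + 1))) (u (w i)) +
        edist (v (w (i + 1))) (v (w i))) := Finset.sum_le_sum fun i _ => edist_add_add_le _ _ _ _
    _ ≤ _ := by
      rw [Finset.sum_add_distrib]
      exact add_le_add (sum_le hw hs) (sum_le hw hs)

lemma neg_eq (u : ℝ → ℝ) (s : Set ℝ) : eVariationOn (fun x => -u x) s = eVariationOn u s := by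
  simp only [eVariationOn, edist_neg_neg]

lemma sub_le (u v : ℝ → ℝ) (s : Set ℝ) :
    eVariationOn (fun x => u x - v x) s ≤ eVariationOn u s + eVariationOn v s := by
  simp only [sub_eq_add_neg]
  exact (add_le u (fun x => -v x) s).trans_eq (by rw [neg_eq])

lemma sum_le_sum (u : ℕ → ℝ → ℝ) (n : ℕ) (s : Set ℝ) :
    eVariationOn (fun x => ∑ i ∈ Finset.range n, u i x) s ≤
      ∑ i ∈ Finset.range n, eVariationOn (u i) s := by
  induction n with
  | zero =>
    simp only [Finset.range_zero, Finset.sum_empty]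
    refine (constant_on (f := fun _ : ℝ => (0 : ℝ)) ?_).le
    rintro _ ⟨x, -, rfl⟩ _ ⟨y, -, rfl⟩
    rfl
  | succ n ih =>
    simp only [Finset.sum_range_succ]
    exact (add_le _ _ s).trans (add_le_add_left ih _)

lemma le_of_lipschitz {C a b : ℝ} (hC : 0 ≤ C)
    (h : ∀ x ∈ Icc a b, ∀ y ∈ Icc a b, |u x - u y| ≤ C * |x - y|) :
    eVariationOn u (Icc a b) ≤ ENNReal.ofReal (C * (b - a)) := by
  have hL : LipschitzOnWith C.toNNReal u (Icc a b) :=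
    LipschitzOnWith.of_dist_le_mul fun x hx y hy => by
      rw [Real.coe_toNNReal _ hC]; exact h x hx y hy
  have := hL.comp_eVariationOn_le (g := id) (mapsTo_id _)
  rwa [eVariationOn_id_Icc, Function.comp_id, ← ENNReal.ofReal, ← ENNReal.ofReal_mul hC] at this

/-- Additivity over the consecutive intervals of an antitone sequence. -/
lemma sum_of_antitone (u : ℝ → ℝ) {p : ℕ → ℝ} (hp : Antitone p) (n : ℕ) :
    ∑ j ∈ Finset.range n, eVariationOn u (Icc (p (j + 1)) (p j)) =
      eVariationOn u (Icc (p n) (p 0)) := by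
  induction n with
  | zero => simp
  | succ n ih =>
    have := Icc_add_Icc u (s := univ) (hp n.le_succ) (hp n.zero_le) (mem_univ _)
    simp only [univ_inter] at this
    rw [Finset.sum_range_succ, ih, add_comm, this]

end eVariationOn

namespace IsDiffTwoDelta

variable {f g : ℝ → ℝ} {K : NNReal}

lemma image_Icc (hf : IsDiffTwoDelta f) {p q : ℝ} (hp : p ∈ Icc (0 : ℝ) 1)
    (hq : q ∈ Icc (0 : ℝ) 1) (hpq : p ≤ q) (n : ℕ) :
    f^[n] '' Icc p q = Icc (f^[n] p) (f^[n] q) := by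
  have hsub : Icc p q ⊆ Icc 0 1 := Icc_subset_Icc hp.1 hq.2
  refine Subset.antisymm ?_ (intermediate_value_Icc hpq ((hf.continuousOn_iterate n).mono hsub))
  rintro _ ⟨x, hx, rfl⟩
  have hm := (hf.strictMonoOn_iterate n).monotoneOn
  exact ⟨hm hp (hsub hx) hx.1, hm (hsub hx) hq hx.2⟩

lemma eVariationOn_comp_iterate (hf : IsDiffTwoDelta f) (u : ℝ → ℝ) {p q : ℝ}
    (hp : p ∈ Icc (0 : ℝ) 1) (hq : q ∈ Icc (0 : ℝ) 1) (hpq : p ≤ q) (n : ℕ) :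
    eVariationOn (fun x => u (f^[n] x)) (Icc p q) =
      eVariationOn u (Icc (f^[n] p) (f^[n] q)) := by
  rw [← hf.image_Icc hp hq hpq n]
  exact eVariationOn.comp_eq_of_monotoneOn u _
    ((hf.strictMonoOn_iterate n).monotoneOn.mono (Icc_subset_Icc hp.1 hq.2))

/-- Chain rule bound for the variation of `log Df^n`. -/
lemma eVariationOn_logDerivUnit_iterate_le (hf : IsDiffTwoDelta f)
    (hK : LipschitzOnWith K (logDerivUnit f) (Icc 0 1)) {p q : ℝ} (hp : p ∈ Icc (0 : ℝ) 1)
    (hq : q ∈ Icc (0 : ℝ) 1) (hpq : p ≤ q) (n : ℕ) :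
    eVariationOn (logDerivUnit f^[n]) (Icc p q) ≤
      ∑ i ∈ Finset.range n, ENNReal.ofReal (K * (f^[i] q - f^[i] p)) := by
  have hsub : Icc p q ⊆ Icc 0 1 := Icc_subset_Icc hp.1 hq.2
  rw [eVariationOn.congr (g := fun x => ∑ i ∈ Finset.range n, logDerivUnit f (f^[i] x))
    fun x hx => hf.logDerivUnit_iterate n (hsub hx)]
  refine (eVariationOn.sum_le_sum _ n _).trans (Finset.sum_le_sum fun i _ => ?_)
  rw [hf.eVariationOn_comp_iterate _ hp hq hpq]
  have hp' := hf.mapsTo.iterate i hp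
  have hq' := hf.mapsTo.iterate i hq
  refine eVariationOn.le_of_lipschitz K.coe_nonneg fun x hx y hy => ?_
  exact hK.dist_le_mul x ⟨hp'.1.trans hx.1, hx.2.trans hq'.2⟩ y
    ⟨hp'.1.trans hy.1, hy.2.trans hq'.2⟩

lemma boundedVariationOn_logDerivUnit_iterate (hf : IsDiffTwoDelta f) (n : ℕ) :
    BoundedVariationOn (logDerivUnit f^[n]) (Icc 0 1) := by
  obtain ⟨K, hK⟩ := hf.exists_lipschitzOnWith
  refine ne_top_of_le_ne_top ?_ (hf.eVariationOn_logDerivUnit_iterate_le hK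
    (left_mem_Icc.2 zero_le_one) (right_mem_Icc.2 zero_le_one) zero_le_one n)
  exact ENNReal.sum_ne_top.2 fun i _ => ENNReal.ofReal_ne_top

lemma iterate_zero_eq (hf : IsDiffTwoDelta f) (n : ℕ) : f^[n] 0 = 0 :=
  Function.iterate_fixed hf.map_zero n

lemma iterate_one_eq (hf : IsDiffTwoDelta f) (n : ℕ) : f^[n] 1 = 1 :=
  Function.iterate_fixed hf.map_one n

lemma subadditive_unitVar (hf : IsDiffTwoDelta f) :
    Subadditive fun n => unitVar (logDerivUnit f^[n]) := by
  intro m n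
  have h1 : eVariationOn (logDerivUnit f^[m + n]) (Icc 0 1) ≤
      eVariationOn (logDerivUnit f^[m]) (Icc 0 1) + eVariationOn (logDerivUnit f^[n]) (Icc 0 1) := by
    have heq : EqOn (logDerivUnit f^[m + n])
        (fun x => logDerivUnit f^[n] x + logDerivUnit f^[m] (f^[n] x)) (Icc 0 1) := by
      intro x hx
      simp only
      rw [hf.logDerivUnit_iterate _ hx, hf.logDerivUnit_iterate _ hx,
        hf.logDerivUnit_iterate _ (hf.mapsTo.iterate n hx), add_comm m n, Finset.sum_range_add]
      simp only [← Function.iterate_add_apply, add_comm]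
    have h0 : (0 : ℝ) ∈ Icc (0 : ℝ) 1 := left_mem_Icc.2 zero_le_one
    have h1 : (1 : ℝ) ∈ Icc (0 : ℝ) 1 := right_mem_Icc.2 zero_le_one
    rw [eVariationOn.congr heq, add_comm (eVariationOn _ _)]
    refine (eVariationOn.add_le _ _ _).trans (add_le_add_right (le_of_eq ?_) _)
    rw [hf.eVariationOn_comp_iterate _ h0 h1 zero_le_one, hf.iterate_zero_eq, hf.iterate_one_eq]
  have hm := hf.boundedVariationOn_logDerivUnit_iterate m
  have hn := hf.boundedVariationOn_logDerivUnit_iterate n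
  exact (ENNReal.toReal_mono (ENNReal.add_ne_top.2 ⟨hm, hn⟩) h1).trans_eq
    (ENNReal.toReal_add hm hn)

lemma tendsto_asymptoticDistortion (hf : IsDiffTwoDelta f) :
    Tendsto (fun n : ℕ => (1 / (n : ℝ)) * unitVar (logDerivUnit f^[n])) atTop
      (𝓝 (asymptoticDistortion f)) := by
  refine tendsto_nhds_limUnder ⟨hf.subadditive_unitVar.lim, ?_⟩
  have := hf.subadditive_unitVar.tendsto_lim
    ⟨0, by rintro _ ⟨n, rfl⟩; exact div_nonneg ENNReal.toReal_nonneg n.cast_nonneg⟩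
  simpa only [div_eq_inv_mul, mul_one] using this

/-- A diffeomorphism and its inverse have the same distortion. -/
lemma unitVar_inv (hf : IsDiffTwoDelta f) (hg : IsDiffTwoDelta g)
    (hinv : InvOn g f (Icc 0 1) (Icc 0 1)) (n : ℕ) :
    unitVar (logDerivUnit f^[n]) = unitVar (logDerivUnit g^[n]) := by
  have heq : EqOn (logDerivUnit f^[n]) (fun x => -logDerivUnit g^[n] (f^[n] x)) (Icc 0 1) := by
    intro x hx
    simp only
    rw [hf.logDerivUnit_iterate n hx, hg.logDerivUnit_iterate n (hf.mapsTo.iterate n hx)]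
    induction n with
    | zero => simp
    | succ n ih =>
      have hfx := hf.mapsTo.iterate n hx
      rw [Finset.sum_range_succ, Finset.sum_range_succ', ih]
      simp only [Function.iterate_succ_apply, Function.iterate_zero, id]
      rw [← Function.iterate_succ_apply f, Function.iterate_succ_apply' f, hinv.1 hfx,
        hf.logDerivUnit_inv hg hinv hfx]
      ring
  have h0 : (0 : ℝ) ∈ Icc (0 : ℝ) 1 := left_mem_Icc.2 zero_le_one
  have h1 : (1 : ℝ) ∈ Icc (0 : ℝ) 1 := right_mem_Icc.2 zero_le_one
  rw [unitVar, eVariationOn.congr heq, eVariationOn.neg_eq,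
    hf.eVariationOn_comp_iterate _ h0 h1 zero_le_one, hf.iterate_zero_eq, hf.iterate_one_eq,
    unitVar]

end IsDiffTwoDelta

/-! ### Comparison of the distortion with the Mather invariant -/

lemma eVariationOn_comp_one_sub (u : ℝ → ℝ) (p q : ℝ) :
    eVariationOn (fun x => u (1 - x)) (Icc (1 - q) (1 - p)) = eVariationOn u (Icc p q) := by
  have h := eVariationOn.comp_eq_of_antitoneOn u (fun x : ℝ => 1 - x) (t := Icc (1 - q) (1 - p))
    (fun x _ y _ hxy => sub_le_sub_left hxy 1)
  rw [image_const_sub_Icc, sub_sub_cancel, sub_sub_cancel] at h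
  exact h

namespace IsOrbit

variable {f X Y φ ψ : ℝ → ℝ}

lemma translate (h : IsOrbit f X φ) (s : ℝ) : IsOrbit f X fun t => φ (t + s) where
  mem t := h.mem _
  hasDerivAt t := (h.hasDerivAt (t + s)).comp_add_const t s
  map_add_one t := by rw [add_right_comm, h.map_add_one]
  continuousOn := h.continuousOn
  ne_zero := h.ne_zero

lemma strictMono_of_gt (h : IsOrbit f X φ) (hgt : ∀ x ∈ Ioo (0 : ℝ) 1, x < f x) :
    StrictMono φ := by
  refine h.strictMono_or_strictAnti.resolve_right fun hφ => ?_
  have h1 := hφ (lt_add_one (0 : ℝ))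
  rw [h.map_add_one] at h1
  exact lt_asymm h1 (hgt _ (h.mem 0))

/-- Over the successive fundamental domains of a contraction, the variation of the logarithm of the
field is asymptotically at most the logarithm of the multiplier at the endpoint. -/
lemma exists_eVariationOn_log_le (h : IsOrbit f X φ) (hf : IsDiffTwoDelta f)
    (hlt : ∀ x ∈ Ioo (0 : ℝ) 1, f x < x) (hX : ContDiffOn ℝ 1 X (Ico 0 1)) :
    ∃ e : ℕ → ℝ, Tendsto e atTop (𝓝 |logDerivUnit f 0|) ∧ ∀ j, 0 ≤ e j ∧
      eVariationOn (fun x => Real.log (X x)) (Icc (f^[j + 1] (φ 0)) (f^[j] (φ 0))) ≤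
        ENNReal.ofReal (e j) := by
  obtain ⟨e, he, hlip⟩ := h.exists_abs_log_sub_le hf hlt hX
  refine ⟨e, he, fun j => ⟨(hlip j).1, ?_⟩⟩
  have hn : ∀ n : ℕ, f^[n] (φ 0) = φ n := fun n => by rw [← h.map_add_nat, zero_add]
  have hle : (j : ℝ) ≤ j + 1 := by linarith
  calc _ ≤ eVariationOn (fun x => Real.log (X x)) (φ '' Icc (j : ℝ) (j + 1)) := by
        refine eVariationOn.mono _ ?_
        rw [hn, hn, Nat.cast_succ]
        exact intermediate_value_Icc' hle h.continuous.continuousOn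
    _ = eVariationOn (fun t => Real.log (X (φ t))) (Icc (j : ℝ) (j + 1)) :=
        (eVariationOn.comp_eq_of_antitoneOn _ φ
          ((h.strictAnti_of_lt hlt).antitone.antitoneOn _)).symm
    _ ≤ ENNReal.ofReal (e j * (j + 1 - j)) :=
        eVariationOn.le_of_lipschitz (hlip j).1 (hlip j).2
    _ = _ := by rw [add_sub_cancel_left, mul_one]

/-- The analogue at the endpoint `1` for a diffeomorphism under which `1` is attracting. -/
lemma exists_eVariationOn_log_le_right (h : IsOrbit f Y ψ) (hf : IsDiffTwoDelta f)
    (hgt : ∀ x ∈ Ioo (0 : ℝ) 1, x < f x) (hY : ContDiffOn ℝ 1 Y (Ioc 0 1)) :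
    ∃ e : ℕ → ℝ, Tendsto e atTop (𝓝 |logDerivUnit f 1|) ∧ ∀ j, 0 ≤ e j ∧
      eVariationOn (fun x => Real.log (Y x)) (Icc (f^[j] (ψ 0)) (f^[j + 1] (ψ 0))) ≤
        ENNReal.ofReal (e j) := by
  have hlt : ∀ x ∈ Ioo (0 : ℝ) 1, 1 - f (1 - x) < x := fun x hx => by
    have := hgt (1 - x) ⟨by linarith [hx.2], by linarith [hx.1]⟩
    linarith
  have hY' : ContDiffOn ℝ 1 (fun x => -Y (1 - x)) (Ico 0 1) := (hY.comp (by fun_prop)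
    fun x (hx : x ∈ Ico (0 : ℝ) 1) => ⟨by linarith [hx.2], by linarith [hx.1]⟩).neg
  obtain ⟨e, he, hvar⟩ := h.reflect.exists_eVariationOn_log_le hf.reflect hlt hY'
  rw [hf.logDerivUnit_reflect (left_mem_Icc.2 zero_le_one), sub_zero] at he
  refine ⟨e, he, fun j => ⟨(hvar j).1, ?_⟩⟩
  have h1 := (hvar j).2
  simp only [IsDiffTwoDelta.reflect_iterate, sub_sub_cancel, Real.log_neg_eq_log] at h1
  rwa [eVariationOn_comp_one_sub (fun x => Real.log (Y x))] at h1

/-- The logarithm of the quotient of two fields is invariant under the diffeomorphism. -/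
lemma log_sub_log_iterate (hX : IsOrbit f X φ) (hY : IsOrbit f Y ψ) (hf : IsDiffTwoDelta f) (n : ℕ)
    {x : ℝ} (hx : x ∈ Ioo (0 : ℝ) 1) :
    Real.log (X (f^[n] x)) - Real.log (Y (f^[n] x)) = Real.log (X x) - Real.log (Y x) := by
  induction n with
  | zero => rfl
  | succ n ih =>
    have hx' := hf.mapsTo_Ioo.iterate n hx
    have h1 := hX.logDeriv hf hx'
    have h2 := hY.logDeriv hf hx'
    rw [Function.iterate_succ_apply']
    linarith

lemma logDeriv_iterate (h : IsOrbit f X φ) (hf : IsDiffTwoDelta f) (n : ℕ) {x : ℝ}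
    (hx : x ∈ Ioo (0 : ℝ) 1) :
    logDerivUnit f^[n] x = Real.log (X (f^[n] x)) - Real.log (X x) := by
  rw [hf.logDerivUnit_iterate n (Ioo_subset_Icc_self hx)]
  induction n with
  | zero => simp
  | succ n ih =>
    rw [Finset.sum_range_succ, ih, h.logDeriv hf (hf.mapsTo_Ioo.iterate n hx),
      Function.iterate_succ_apply']
    ring

/-- The quantitative comparison for a diffeomorphism moving the points towards `1`. The interval is
cut at `g^n a` and `a`, with `g` the inverse of `f`. On the outer pieces `log Df^n` has variation
`o(n)`. On the middle piece `log Df^n = log (X / Y) + log (Y ∘ f^n) - log X`, where the first term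
has variation `n W` by invariance, and the two others are controlled over each fundamental domain. -/
lemma exists_abs_unitVar_sub_le (hX : IsOrbit f X φ) (hY : IsOrbit f Y ψ) (hf : IsDiffTwoDelta f)
    (hgt : ∀ x ∈ Ioo (0 : ℝ) 1, x < f x) (hXC : ContDiffOn ℝ 1 X (Ico 0 1))
    (hYC : ContDiffOn ℝ 1 Y (Ioc 0 1))
    (hW : BoundedVariationOn (fun t => Real.log (X (φ t)) - Real.log (Y (φ t))) (Icc 0 1)) :
    ∃ ε : ℕ → ℝ, Tendsto ε atTop (𝓝 (|logDerivUnit f 0| + |logDerivUnit f 1|)) ∧ ∀ n : ℕ,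
      |unitVar (logDerivUnit f^[n]) -
          n * unitVar fun t => Real.log (X (φ t)) - Real.log (Y (φ t))| ≤
        ∑ j ∈ Finset.range n, ε j := by
  obtain ⟨g, hg, hinv⟩ := hf.exists_inv
  obtain ⟨K, hK⟩ := hf.exists_lipschitzOnWith
  have hglt := IsDiffTwoDelta.inv_lt hg hinv hgt
  have hflt : ∀ x ∈ Ioo (0 : ℝ) 1, 1 - f (1 - x) < x := fun x hx => by
    have := hgt (1 - x) ⟨by linarith [hx.2], by linarith [hx.1]⟩
    linarith
  obtain ⟨a, haφ⟩ : ∃ a, a = φ 1 := ⟨_, rfl⟩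
  have ha : a ∈ Ioo (0 : ℝ) 1 := haφ ▸ hX.mem 1
  have haI := Ioo_subset_Icc_self ha
  have hga : g a = φ 0 := by
    have := hX.map_add_one 0
    rw [zero_add] at this
    rw [haφ, this, hinv.1 (Ioo_subset_Icc_self (hX.mem 0))]
  -- the variation of `log X` and `log Y` over the fundamental domains
  obtain ⟨e, he, hvar⟩ := (hX.inv hinv).exists_eVariationOn_log_le hg hglt hXC.neg
  simp only [Real.log_neg_eq_log, sub_zero, ← haφ] at hvar
  have h0 : |logDerivUnit g 0| = |logDerivUnit f 0| := by
    rw [hf.logDerivUnit_inv hg hinv (left_mem_Icc.2 zero_le_one), hf.map_zero, abs_neg]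
  rw [h0] at he
  obtain ⟨s, hs⟩ := hY.exists_eq hf ha
  obtain ⟨e', he', hvar'⟩ := (hY.translate s).exists_eVariationOn_log_le_right hf hgt hYC
  simp only [zero_add, hs] at hvar'
  have hanti := hg.antitone_iterate hglt haI
  have hmono : Monotone fun n => f^[n] a := monotone_nat_of_le_succ fun n => by
    rw [Function.iterate_succ_apply']
    exact (hgt _ (hf.mapsTo_Ioo.iterate n ha)).le
  have hx1 : Tendsto (fun n => 1 - f^[n] a) atTop (𝓝 0) := by
    have := hf.reflect.tendsto_iterate hflt (x := 1 - a) ⟨by linarith [ha.2], by linarith [ha.1]⟩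
    simpa only [IsDiffTwoDelta.reflect_iterate, sub_sub_cancel] using this
  have hy0 := (tendsto_add_atTop_iff_nat 1).2 (hg.tendsto_iterate hglt (Ioo_subset_Ico_self ha))
  have hyI : ∀ n, g^[n] a ∈ Ioo (0 : ℝ) 1 := fun n => hg.mapsTo_Ioo.iterate n ha
  have hxI : ∀ n, f^[n] a ∈ Ioo (0 : ℝ) 1 := fun n => hf.mapsTo_Ioo.iterate n ha
  refine ⟨fun j => K * g^[j + 1] a + K * (1 - f^[j] a) + (e j + e' j), ?_, fun n => ?_⟩
  · simpa using ((hy0.const_mul (K : ℝ)).add (hx1.const_mul (K : ℝ))).add (he.add he')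
  have hε1 : ∀ j, 0 ≤ K * g^[j + 1] a := fun j => mul_nonneg K.coe_nonneg (hyI _).1.le
  have hε2 : ∀ j, 0 ≤ K * (1 - f^[j] a) := fun j =>
    mul_nonneg K.coe_nonneg (sub_nonneg.2 (hxI _).2.le)
  have hε3 : ∀ j, 0 ≤ e j + e' j := fun j => add_nonneg (hvar j).1 (hvar' j).1
  set w : ℝ → ℝ := fun x => Real.log (X x) - Real.log (Y x) with hw
  set W := eVariationOn (fun t => Real.log (X (φ t)) - Real.log (Y (φ t))) (Icc 0 1) with hWdef
  -- the variation of `log (X / Y)` over `[g^n a, a]`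
  have hwW : eVariationOn w (Icc (g^[n] a) a) = n * W := by
    have hφ : φ '' Icc 0 1 = Icc (g a) a := by
      rw [hga, haφ]
      refine Subset.antisymm ?_ (intermediate_value_Icc zero_le_one hX.continuous.continuousOn)
      have hm := (hX.strictMono_of_gt hgt).monotone
      rintro _ ⟨t, ht, rfl⟩
      exact ⟨hm ht.1, hm ht.2⟩
    have hone : eVariationOn w (Icc (g a) a) = W := by
      rw [← hφ]
      exact (eVariationOn.comp_eq_of_monotoneOn w φ
        ((hX.strictMono_of_gt hgt).monotone.monotoneOn _)).symm
    have hterm : ∀ j, eVariationOn w (Icc (g^[j + 1] a) (g^[j] a)) = W := by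
      intro j
      rw [Function.iterate_succ_apply, ← hg.eVariationOn_comp_iterate w
        (hg.mapsTo haI) haI (hglt a ha).le, ← hone]
      refine eVariationOn.congr fun x hx => ?_
      have hx' : x ∈ Ioo (0 : ℝ) 1 :=
        ⟨(hg.mapsTo_Ioo ha).1.trans_le hx.1, hx.2.trans_lt ha.2⟩
      have := (hX.inv hinv).log_sub_log_iterate (hY.inv hinv) hg j hx'
      simpa only [Real.log_neg_eq_log] using this
    have := eVariationOn.sum_of_antitone w hanti n
    simp only [hterm, Function.iterate_zero, id] at this
    rw [← this]
    simp
  -- the two error terms on the middle piece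
  have hR : eVariationOn (fun x => Real.log (Y (f^[n] x)) - Real.log (X x)) (Icc (g^[n] a) a) ≤
      ENNReal.ofReal (∑ j ∈ Finset.range n, (e j + e' j)) := by
    have h1 : eVariationOn (fun x => Real.log (X x)) (Icc (g^[n] a) a) ≤
        ∑ j ∈ Finset.range n, ENNReal.ofReal (e j) := by
      have := eVariationOn.sum_of_antitone (fun x => Real.log (X x)) hanti n
      simp only [Function.iterate_zero, id] at this
      rw [← this]
      exact Finset.sum_le_sum fun j _ => (hvar j).2
    have h2 : eVariationOn (fun x => Real.log (Y (f^[n] x))) (Icc (g^[n] a) a) ≤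
        ∑ j ∈ Finset.range n, ENNReal.ofReal (e' j) := by
      rw [hf.eVariationOn_comp_iterate (fun x => Real.log (Y x))
        (Ioo_subset_Icc_self (hyI n)) haI (hanti n.zero_le), hg.iterate_inv hinv.symm n haI]
      have := eVariationOn.sum' (fun x => Real.log (Y x)) hmono (n := n)
      simp only [Function.iterate_zero, id] at this
      rw [← this]
      exact Finset.sum_le_sum fun j _ => (hvar' j).2
    refine (eVariationOn.sub_le _ _ _).trans ((add_le_add h2 h1).trans_eq ?_)
    rw [ENNReal.ofReal_sum_of_nonneg fun j _ => hε3 j, add_comm, ← Finset.sum_add_distrib]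
    exact Finset.sum_congr rfl fun j _ => (ENNReal.ofReal_add (hvar j).1 (hvar' j).1).symm
  have hmid : ∀ x ∈ Icc (g^[n] a) a,
      logDerivUnit f^[n] x = w x + (Real.log (Y (f^[n] x)) - Real.log (X x)) := by
    intro x hx
    rw [hY.logDeriv_iterate hf n ⟨(hyI n).1.trans_le hx.1, hx.2.trans_lt ha.2⟩, hw]
    ring
  have hB1 : eVariationOn (logDerivUnit f^[n]) (Icc (g^[n] a) a) ≤
      n * W + ENNReal.ofReal (∑ j ∈ Finset.range n, (e j + e' j)) := by
    rw [eVariationOn.congr hmid, ← hwW]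
    exact (eVariationOn.add_le _ _ _).trans (add_le_add_right hR _)
  have hB2 : n * W ≤ eVariationOn (logDerivUnit f^[n]) (Icc (g^[n] a) a) +
      ENNReal.ofReal (∑ j ∈ Finset.range n, (e j + e' j)) := by
    have heq : EqOn w (fun x => logDerivUnit f^[n] x -
        (Real.log (Y (f^[n] x)) - Real.log (X x))) (Icc (g^[n] a) a) := fun x hx => by
      simp only [hmid x hx]; ring
    rw [← hwW, eVariationOn.congr heq]
    exact (eVariationOn.sub_le _ _ _).trans (add_le_add_right hR _)
  -- the outer pieces
  have hA : eVariationOn (logDerivUnit f^[n]) (Icc 0 (g^[n] a)) ≤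
      ENNReal.ofReal (∑ j ∈ Finset.range n, K * g^[j + 1] a) := by
    refine (hf.eVariationOn_logDerivUnit_iterate_le hK (left_mem_Icc.2 zero_le_one)
      (Ioo_subset_Icc_self (hyI n)) (hyI n).1.le n).trans (le_of_eq ?_)
    rw [ENNReal.ofReal_sum_of_nonneg fun j _ => hε1 j, ← Finset.sum_range_reflect]
    refine Finset.sum_congr rfl fun j hj => ?_
    have hj' := Finset.mem_range.1 hj
    -- `f^(n-1-j) (g^n a) = g^(j+1) a`
    have h1 : g^[n] a = g^[n - 1 - j] (g^[j + 1] a) := by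
      rw [← Function.iterate_add_apply]; congr 2; omega
    rw [hf.iterate_zero_eq, sub_zero, h1,
      hg.iterate_inv hinv.symm _ (Ioo_subset_Icc_self (hyI (j + 1)))]
  have hC : eVariationOn (logDerivUnit f^[n]) (Icc a 1) ≤
      ENNReal.ofReal (∑ j ∈ Finset.range n, K * (1 - f^[j] a)) := by
    refine (hf.eVariationOn_logDerivUnit_iterate_le hK haI (right_mem_Icc.2 zero_le_one)
      ha.2.le n).trans (le_of_eq ?_)
    rw [ENNReal.ofReal_sum_of_nonneg fun j _ => hε2 j]
    simp only [hf.iterate_one_eq]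
  have hsplit : eVariationOn (logDerivUnit f^[n]) (Icc 0 1) =
      eVariationOn (logDerivUnit f^[n]) (Icc 0 (g^[n] a)) +
        eVariationOn (logDerivUnit f^[n]) (Icc (g^[n] a) a) +
        eVariationOn (logDerivUnit f^[n]) (Icc a 1) := by
    have hya : g^[n] a ≤ a := hanti n.zero_le
    have h1 := eVariationOn.Icc_add_Icc (logDerivUnit f^[n]) (s := univ) (hyI n).1.le hya
      (mem_univ _)
    have h2 := eVariationOn.Icc_add_Icc (logDerivUnit f^[n]) (s := univ) ha.1.le ha.2.le
      (mem_univ _)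
    simp only [univ_inter] at h1 h2
    rw [h1, h2]
  have hsum : ENNReal.ofReal (∑ j ∈ Finset.range n,
      (K * g^[j + 1] a + K * (1 - f^[j] a) + (e j + e' j))) =
      ENNReal.ofReal (∑ j ∈ Finset.range n, K * g^[j + 1] a) +
      ENNReal.ofReal (∑ j ∈ Finset.range n, K * (1 - f^[j] a)) +
      ENNReal.ofReal (∑ j ∈ Finset.range n, (e j + e' j)) := by
    rw [Finset.sum_add_distrib, Finset.sum_add_distrib, ENNReal.ofReal_add, ENNReal.ofReal_add] <;>
    first
      | exact Finset.sum_nonneg fun j _ => hε1 j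
      | exact Finset.sum_nonneg fun j _ => hε2 j
      | exact Finset.sum_nonneg fun j _ => hε3 j
      | exact add_nonneg (Finset.sum_nonneg fun j _ => hε1 j)
          (Finset.sum_nonneg fun j _ => hε2 j)
  set S := ∑ j ∈ Finset.range n, (K * g^[j + 1] a + K * (1 - f^[j] a) + (e j + e' j)) with hS
  have hS0 : 0 ≤ S := Finset.sum_nonneg fun j _ => add_nonneg (add_nonneg (hε1 j) (hε2 j)) (hε3 j)
  have hupper : eVariationOn (logDerivUnit f^[n]) (Icc 0 1) ≤ n * W + ENNReal.ofReal S := by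
    rw [hsplit, hsum]
    refine (add_le_add (add_le_add hA hB1) hC).trans_eq ?_
    ring
  have hlower : n * W ≤ eVariationOn (logDerivUnit f^[n]) (Icc 0 1) + ENNReal.ofReal S := by
    refine hB2.trans (add_le_add ?_ ?_)
    · rw [hsplit]
      exact le_self_add.trans' le_add_self
    · rw [hsum]
      exact le_add_self
  have hV := hf.boundedVariationOn_logDerivUnit_iterate n
  have hnW : (n : ENNReal) * W ≠ ⊤ := ENNReal.mul_ne_top (ENNReal.natCast_ne_top n) hW
  have hu := ENNReal.toReal_mono (ENNReal.add_ne_top.2 ⟨hnW, ENNReal.ofReal_ne_top⟩) hupper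
  have hl := ENNReal.toReal_mono (ENNReal.add_ne_top.2 ⟨hV, ENNReal.ofReal_ne_top⟩) hlower
  rw [ENNReal.toReal_add hnW ENNReal.ofReal_ne_top, ENNReal.toReal_ofReal hS0, ENNReal.toReal_mul,
    ENNReal.toReal_natCast] at hu
  rw [ENNReal.toReal_add hV ENNReal.ofReal_ne_top, ENNReal.toReal_ofReal hS0, ENNReal.toReal_mul,
    ENNReal.toReal_natCast] at hl
  rw [abs_le, unitVar, unitVar]
  constructor <;> linarith

lemma abs_asymptoticDistortion_sub_le_of_gt (hX : IsOrbit f X φ) (hY : IsOrbit f Y ψ)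
    (hf : IsDiffTwoDelta f) (hgt : ∀ x ∈ Ioo (0 : ℝ) 1, x < f x)
    (hXC : ContDiffOn ℝ 1 X (Ico 0 1)) (hYC : ContDiffOn ℝ 1 Y (Ioc 0 1))
    (hW : BoundedVariationOn (fun t => Real.log (X (φ t)) - Real.log (Y (φ t))) (Icc 0 1)) :
    |asymptoticDistortion f - unitVar fun t => Real.log (X (φ t)) - Real.log (Y (φ t))| ≤
      |logDerivUnit f 0| + |logDerivUnit f 1| := by
  obtain ⟨ε, hε, hle⟩ := hX.exists_abs_unitVar_sub_le hY hf hgt hXC hYC hW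
  refine le_of_tendsto_of_tendsto
    (hf.tendsto_asymptoticDistortion.sub_const _).abs hε.cesaro ?_
  filter_upwards [eventually_gt_atTop 0] with n hn
  have hn' : (0 : ℝ) < n := Nat.cast_pos.2 hn
  have := mul_le_mul_of_nonneg_left (hle n) (inv_pos.2 hn').le
  rw [← abs_of_pos (inv_pos.2 hn'), ← abs_mul, mul_sub, inv_mul_cancel_left₀ hn'.ne',
    abs_of_pos (inv_pos.2 hn')] at this
  rwa [one_div]

/-- The comparison in general: inversion exchanges the two directions of motion and preserves both
quantities. -/
lemma abs_asymptoticDistortion_sub_le (hX : IsOrbit f X φ) (hY : IsOrbit f Y ψ)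
    (hf : IsDiffTwoDelta f) (hXC : ContDiffOn ℝ 1 X (Ico 0 1)) (hYC : ContDiffOn ℝ 1 Y (Ioc 0 1))
    (hW : BoundedVariationOn (fun t => Real.log (X (φ t)) - Real.log (Y (φ t))) (Icc 0 1)) :
    |asymptoticDistortion f - unitVar fun t => Real.log (X (φ t)) - Real.log (Y (φ t))| ≤
      |logDerivUnit f 0| + |logDerivUnit f 1| := by
  rcases hf.forall_lt_or_forall_gt with hlt | hgt
  · obtain ⟨g, hg, hinv⟩ := hf.exists_inv
    have hvar : eVariationOn (fun t => Real.log (-X (φ (1 - t))) - Real.log (-Y (φ (1 - t))))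
        (Icc 0 1) = eVariationOn (fun t => Real.log (X (φ t)) - Real.log (Y (φ t))) (Icc 0 1) := by
      simp only [Real.log_neg_eq_log]
      simpa using eVariationOn_comp_one_sub
        (fun t => Real.log (X (φ t)) - Real.log (Y (φ t))) 0 1
    have h1 := (hX.inv hinv).abs_asymptoticDistortion_sub_le_of_gt (hY.inv hinv) hg
      (IsDiffTwoDelta.inv_gt hg hinv hlt) hXC.neg hYC.neg (by
        rw [BoundedVariationOn, hvar]; exact hW)
    have h2 : asymptoticDistortion g = asymptoticDistortion f := by
      simp only [asymptoticDistortion, hf.unitVar_inv hg hinv]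
    have h3 := hf.logDerivUnit_inv hg hinv (left_mem_Icc.2 zero_le_one)
    have h4 := hf.logDerivUnit_inv hg hinv (right_mem_Icc.2 zero_le_one)
    rw [hf.map_zero] at h3
    rw [hf.map_one] at h4
    rw [h3, h4, abs_neg, abs_neg, ← h2]
    rwa [unitVar, hvar] at h1
  · exact hX.abs_asymptoticDistortion_sub_le_of_gt hY hf hgt hXC hYC hW

end IsOrbit

/-- For `f` in `Diff^{2,Δ}_+([0,1])`: the Mather invariant is a well-defined class of `C^2` circle
diffeomorphisms modulo rotations, the limit defining the asymptotic distortion exists (all variations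
being finite), and, for every representative `M` of the Mather invariant, the asymptotic distortion
differs from `var (log DM)` by at most `|log Df(0)| + |log Df(1)|`; the two are equal if `f` is tangent
to the identity at both endpoints. -/
theorem theoremE (f : ℝ → ℝ) (hf : IsDiffTwoDelta f) :
    IsRotationClass (matherInvariant f) ∧
    (∀ n : ℕ, BoundedVariationOn (logDerivUnit f^[n]) (Icc 0 1)) ∧
    Tendsto (fun n : ℕ => (1 / (n : ℝ)) * unitVar (logDerivUnit f^[n])) atTop
      (𝓝 (asymptoticDistortion f)) ∧
    ∀ M ∈ matherInvariant f,
      BoundedVariationOn (fun t => Real.log (deriv M t)) (Icc 0 1) ∧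
      |asymptoticDistortion f - unitVar (fun t => Real.log (deriv M t))| ≤
        |Real.log (derivWithin f (Icc 0 1) 0)| + |Real.log (derivWithin f (Icc 0 1) 1)| ∧
      (derivWithin f (Icc 0 1) 0 = 1 → derivWithin f (Icc 0 1) 1 = 1 →
        asymptoticDistortion f = unitVar (fun t => Real.log (deriv M t))) := by
  refine ⟨isRotationClass_matherInvariant hf, hf.boundedVariationOn_logDerivUnit_iterate,
    hf.tendsto_asymptoticDistortion, ?_⟩
  rintro M ⟨X, Y, Φ, Ψ, a, b, hX, hY, ha, hb, hM⟩
  have hXo := hX.isOrbit hf ha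
  have hYo := hY.isOrbit_Ioc hf hb
  obtain ⟨hM2, hMpos, -⟩ := hXo.isCircleDiffTwoLift hYo hf
    (hX.contDiffOn.mono Ioo_subset_Ico_self) (hY.contDiffOn.mono Ioo_subset_Ioc_self) hM
  have hlog : (fun t => Real.log (deriv M t)) =
      fun t => Real.log (X (Φ t a)) - Real.log (Y (Φ t a)) := funext fun t => by
    rw [(hXo.hasDerivAt_transition hYo hM t).deriv,
      Real.log_div (hXo.ne_zero _ (hXo.mem t)) (hYo.ne_zero _ (hXo.mem t))]
  have hBV : BoundedVariationOn (fun t => Real.log (deriv M t)) (Icc 0 1) := by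
    have hC : ContDiff ℝ 1 fun t => Real.log (deriv M t) := by
      rw [show (2 : WithTop ℕ∞) = 1 + 1 by norm_num, contDiff_succ_iff_deriv] at hM2
      exact hM2.2.2.log fun t => (hMpos t).ne'
    obtain ⟨K, hK⟩ := hC.contDiffOn.exists_lipschitzOnWith one_ne_zero
      (convex_Icc (0 : ℝ) 1) isCompact_Icc
    exact hK.comp_boundedVariationOn (mapsTo_id _) (BoundedVariationOn.id_Icc 0 1)
  have hle : |asymptoticDistortion f - unitVar (fun t => Real.log (deriv M t))| ≤
      |logDerivUnit f 0| + |logDerivUnit f 1| := by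
    rw [hlog] at hBV ⊢
    exact hXo.abs_asymptoticDistortion_sub_le hYo hf hX.contDiffOn hY.contDiffOn hBV
  refine ⟨hBV, hle, fun h0 h1 => ?_⟩
  rw [logDerivUnit, logDerivUnit, h0, h1, Real.log_one, abs_zero, add_zero] at hle
  exact sub_eq_zero.1 (abs_nonpos_iff.1 hle)
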